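/- **Conventions.** A *doctrine* is a functor $P:\mathcal C^{op}\to\mathbf{Pos}$, where $\mathcal C$ has finite products (terminal object $\mathbf t$); a *morphism* $P\to R$ (with $R:\mathcal D^{op}\to\mathbf{Pos}$) is a pair $(F,\mathfrak f)$ of a finite-product-preserving functor $F:\mathcal C\to\mathcal D$ and a natural transformation $\mathfrak f:P\to R\circ F^{op}$. $P$ is *primary* if its fibers have finite meets preserved by reindexing; *implicational* if its fibers are cartesian closed posets and reindexing preserves $\wedge,\top,\to$; *bounded* if its fibers have $\top,\bot$ preserved by reindexing; *existential* if it is primary and each $P(\mathrm{pr}_1):P(C)\to P(C\times B)$ has a left adjoint $\exists^B_C$ satisfying Beck–Chevalley ($\exists^B_CP(f\times\mathrm{id}_B)=P(f)\exists^B_{C'}$ for $f:C\to C'$) and Frobenius reciprocity; *universal* if each $P(\mathrm{pr}_1)$ has a right adjoint satisfying Beck–Chevalley; *elementary* if it is primary and there are $\delta_A\in P(A\times A)$ with $\top_A\le P(\Delta_A)\delta_A$, with $P(\mathrm{pr}_1)\alpha\wedge\delta_A\le P(\mathrm{pr}_2)\alpha$ for all $\alpha\in P(A)$, and with $P(\langle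 \mathrm{pr}_1,\mathrm{pr}_3\rangle)\delta_A\wedge P(\langle \mathrm{pr}_2,\mathrm{pr}_4\rangle)\delta_B\le\delta_{A\times B}$. A morphism has one of these properties if its source and target do and $\mathfrak f$ preserves the structure. An existential doctrine $R$ is *rich* if for all $A$ and $\sigma\in R(A)$ there is $d:\mathbf t\to A$ with $\exists^A_{\mathbf t}\sigma\le R(d)\sigma$. **Construction.** Let $P:\mathcal C^{op}\to\mathbf{Pos}$ be an implicational existential doctrine with small base $\mathcal C$, and $\Lambda=\mathrm{card}\big(\bigsqcup_{X}P(X)\big)$, regarded as an initial ordinal. Let $J$ be the set of finite lists $\bar X=((X_1,x_1),\dots,(X_n,x_n))$ with distinct entries in $\mathrm{ob}\,\mathcal C\times\Lambda$, preordered by inclusion of the sets of entries; write $\Pi\bar X=\prod_aX_a$. The doctrine $\underline P:\underline{\mathcal C}^{op}\to\mathbf{Pos}$ is the directed colimit over $J$ of the doctrines $A\mapsto P(\Pi\bar X\times A)$: $\underline{\mathcal C}$ has the objects of $\mathcal C$; arrows $A\to B$ are classes $[f,\bar X]$ of arrows $f:\Pi\bar X\times A\to B$; elements of $\underline P(A)$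 are classes $[\varphi,\bar X]$ with $\varphi\in P(\Pi\bar X\times A)$; representatives are identified (and, for elements, ordered) when they are so after reindexing to a common larger list. An *admissible listing* consists, for each object $B$, of a listing $([\varphi^B_j,\bar X^{(B,j)}])_{j\in\Lambda}$ of all the elements of $\underline P(B)$ (repetitions allowed) with chosen representatives, such that the ordinals $d^B_j$ defined recursively by $$d^B_j=\min\{o: o>d^B_h\ \text{for all } h<j,\text{ and } o>x\ \text{for every entry } (X,x)\text{ of } \bar X^{(B,k)}\text{ and every } k\le j\}$$ all belong to $\Lambda$. Given one, let $\bar X^{(B,j)}_\star$ be $\bar X^{(B,j)}$ with the entry $(B,d^B_j)$ added, let $\psi^B_j=\big(P(\mathrm{pr}_1)\exists^B_{\Pi\bar X^{(B,j)}}\varphi^B_j\to\varphi^B_j\big)\in P(\Pi\bar X^{(B,j)}\times B)$, and regard $[\psi^B_j,\bar X^{(B,j)}_\star]$ as an element of $\underline P(\mathbf t)$. Then $\underrightarrow P:\underline{\mathcal C}^{op}\to\mathbf{Pos}$ is the directed colimit, over the finite sets $\mathcal U$ of pairs $(B,j)$, of the doctrines $$A\mapsto\Big\{\alpha\in\underline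 P(A):\alpha\le\underline P(!)\bigwedge_{(B,j)\in\mathcal U}[\psi^B_j,\bar X^{(B,j)}_\star]\Big\},$$ with transition maps given by meeting with the larger conjunction. The morphism $(F,\mathfrak f):P\to\underrightarrow P$ is $Ff=[f,\emptyset]$, $\mathfrak f_A(\alpha)=[[\alpha,\emptyset],\emptyset]$. **Theorem.** Let $P$ be an implicational existential doctrine with a small base category. Admissible listings exist. For each of them, $(F,\mathfrak f):P\to\underrightarrow P$ is an implicational existential morphism, $\underrightarrow P$ is rich, and $(F,\mathfrak f)$ is weakly universal with this property: for every implicational existential rich doctrine $R$ and every implicational existential morphism $(H,\mathfrak h):P\to R$ there is an implicational existential morphism $(G,\mathfrak g):\underrightarrow P\to R$ with $(G,\mathfrak g)\circ(F,\mathfrak f)=(H,\mathfrak h)$. Moreover, if $P$, $R$ and $(H,\mathfrak h)$ are bounded (respectively universal, elementary), then every such $(G,\mathfrak g)$ is bounded (respectively universal, elementary). -/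

import Mathlib

open CategoryTheory Limits MonoidalCategory CartesianMonoidalCategory Opposite

universe u v w u₂ v₂ w₂ u₃ v₃ w₃ x

namespace RichDoctrine

section Doctrines

variable {C : Type u} [Category.{v} C]

/-- The fiber `P(A)` of a doctrine. -/
abbrev Fib (P : Cᵒᵖ ⥤ PartOrd.{w}) (A : C) : Type w := P.obj (op A)

/-- The reindexing `P(f) : P(B) → P(A)` along `f : A ⟶ B`. -/
def re (P : Cᵒᵖ ⥤ PartOrd.{w}) {A B : C} (f : A ⟶ B) : Fib P B →o Fib P A := (P.map f.op).hom

theorem re_id (P : Cᵒᵖ ⥤ PartOrd.{w}) {A : C} (α : Fib P A) : re P (𝟙 A) α = α := by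
  simp [re]

theorem re_comp (P : Cᵒᵖ ⥤ PartOrd.{w}) {A B D : C} (f : A ⟶ B) (g : B ⟶ D) (α : Fib P D) :
    re P (f ≫ g) α = re P f (re P g α) := by
  simp [re]

/-- `P` is a primary doctrine: the fibers have finite meets and reindexing preserves them. -/
structure IsPrimary (P : Cᵒᵖ ⥤ PartOrd.{w}) : Prop where
  exists_top : ∀ A : C, ∃ t : Fib P A, IsTop t
  exists_meet : ∀ {A : C} (α β : Fib P A), ∃ m, IsGLB {α, β} m
  re_top : ∀ {A B : C} (f : A ⟶ B) {t : Fib P B}, IsTop t → IsTop (re P f t)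
  re_meet : ∀ {A B : C} (f : A ⟶ B) {α β m : Fib P B}, IsGLB {α, β} m →
    IsGLB {re P f α, re P f β} (re P f m)

/-- In a poset with binary meets, `i` is the implication `α → β`: `γ ≤ i` iff `γ ∧ α ≤ β`. -/
def IsImp {X : Type*} [PartialOrder X] (α β i : X) : Prop :=
  ∀ γ m, IsGLB {γ, α} m → (γ ≤ i ↔ m ≤ β)

/-- `P` is an implicational doctrine: the fibers are cartesian closed posets, and reindexing
preserves finite meets and implications. -/
structure IsImplicational (P : Cᵒᵖ ⥤ PartOrd.{w}) : Prop extends IsPrimary P where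
  exists_imp : ∀ {A : C} (α β : Fib P A), ∃ i, IsImp α β i
  re_imp : ∀ {A B : C} (f : A ⟶ B) {α β i : Fib P B}, IsImp α β i →
    IsImp (re P f α) (re P f β) (re P f i)

/-- `P` is a bounded doctrine: the fibers have top and bottom, preserved by reindexing. -/
structure IsBounded (P : Cᵒᵖ ⥤ PartOrd.{w}) : Prop where
  exists_top : ∀ A : C, ∃ t : Fib P A, IsTop t
  exists_bot : ∀ A : C, ∃ b : Fib P A, IsBot b
  re_top : ∀ {A B : C} (f : A ⟶ B) {t : Fib P B}, IsTop t → IsTop (re P f t)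
  re_bot : ∀ {A B : C} (f : A ⟶ B) {b : Fib P B}, IsBot b → IsBot (re P f b)

variable [CartesianMonoidalCategory C]

/-- `e ∈ P(D)` is the value at `α ∈ P(D × B)` of the left adjoint `∃^B_D` of `P(pr₁)`. -/
def IsEx (P : Cᵒᵖ ⥤ PartOrd.{w}) {D B : C} (α : Fib P (D ⊗ B)) (e : Fib P D) : Prop :=
  ∀ β : Fib P D, e ≤ β ↔ α ≤ re P (fst D B) β

/-- `e ∈ P(D)` is the value at `α ∈ P(D × B)` of the right adjoint `∀^B_D` of `P(pr₁)`. -/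
def IsAll (P : Cᵒᵖ ⥤ PartOrd.{w}) {D B : C} (α : Fib P (D ⊗ B)) (e : Fib P D) : Prop :=
  ∀ β : Fib P D, β ≤ e ↔ re P (fst D B) β ≤ α

/-- `P` is an existential doctrine: it is primary, reindexing along first projections has a left
adjoint, and the Beck-Chevalley condition and Frobenius reciprocity hold. -/
structure IsExistential (P : Cᵒᵖ ⥤ PartOrd.{w}) : Prop extends IsPrimary P where
  exists_ex : ∀ {D B : C} (α : Fib P (D ⊗ B)), ∃ e, IsEx P α e
  beck_chevalley : ∀ {D D' B : C} (f : D ⟶ D') {α : Fib P (D' ⊗ B)} {e : Fib P D'},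
    IsEx P α e → IsEx P (re P (f ▷ B) α) (re P f e)
  frobenius : ∀ {D B : C} {α m : Fib P (D ⊗ B)} {β e n : Fib P D}, IsEx P α e →
    IsGLB {α, re P (fst D B) β} m → IsGLB {e, β} n → IsEx P m n

/-- `P` is a universal doctrine: reindexing along first projections has a right adjoint, and the
Beck-Chevalley condition holds. -/
structure IsUniversal (P : Cᵒᵖ ⥤ PartOrd.{w}) : Prop where
  exists_all : ∀ {D B : C} (α : Fib P (D ⊗ B)), ∃ e, IsAll P α e
  beck_chevalley : ∀ {D D' B : C} (f : D ⟶ D') {α : Fib P (D' ⊗ B)} {e : Fib P D'},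
    IsAll P α e → IsAll P (re P (f ▷ B) α) (re P f e)

/-- The family `δ` is a fibered equality on `P`. -/
structure IsFiberedEq (P : Cᵒᵖ ⥤ PartOrd.{w}) (δ : ∀ A : C, Fib P (A ⊗ A)) : Prop where
  refl : ∀ A, IsTop (re P (lift (𝟙 A) (𝟙 A)) (δ A))
  subst : ∀ {A : C} (α : Fib P A) {m : Fib P (A ⊗ A)}, IsGLB {re P (fst A A) α, δ A} m →
    m ≤ re P (snd A A) α
  prod : ∀ {A B : C} {m : Fib P ((A ⊗ B) ⊗ (A ⊗ B))},
    IsGLB {re P (fst A B ⊗ₘ fst A B) (δ A), re P (snd A B ⊗ₘ snd A B) (δ B)} m → m ≤ δ (A ⊗ B)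

/-- `P` is an elementary doctrine: it is primary and has a fibered equality. -/
structure IsElementary (P : Cᵒᵖ ⥤ PartOrd.{w}) : Prop extends IsPrimary P where
  exists_eq : ∃ δ : ∀ A : C, Fib P (A ⊗ A), IsFiberedEq P δ

/-- `P` is a rich doctrine: it is existential, and for every `σ ∈ P(A)` there is a constant
`d : t ⟶ A` with `∃^A_t σ ≤ P(d)σ` (`σ` is seen in `P(t × A)` along the projection to `A`). -/
structure IsRich (P : Cᵒᵖ ⥤ PartOrd.{w}) : Prop extends IsExistential P where
  exists_witness : ∀ {A : C} (σ : Fib P A), ∃ d : 𝟙_ C ⟶ A, ∀ e : Fib P (𝟙_ C),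
    IsEx P (re P (snd (𝟙_ C) A) σ) e → e ≤ re P d σ

end Doctrines

section Operations

variable {C : Type u} [Category.{v} C]

theorem IsPrimary.exists_bigMeet {P : Cᵒᵖ ⥤ PartOrd.{w}} (hP : IsPrimary P) {A : C} {ι : Type x}
    (s : Finset ι) (φ : ι → Fib P A) : ∃ m, IsGLB (φ '' s) m := by
  classical
  induction s using Finset.induction_on with
  | empty =>
    obtain ⟨t, ht⟩ := hP.exists_top A
    exact ⟨t, by simpa using ht⟩
  | insert a s _ ih =>
    obtain ⟨m, hm⟩ := ih
    obtain ⟨n, hn⟩ := hP.exists_meet (φ a) m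
    refine ⟨n, ?_⟩
    rw [Finset.coe_insert, Set.image_insert_eq]
    refine (isGLB_congr ?_).1 hn
    simp [lowerBounds_insert, hm.lowerBounds_eq]

/-- The meet `α ∧ β` in a fiber of a primary doctrine. -/
noncomputable def IsPrimary.meet {P : Cᵒᵖ ⥤ PartOrd.{w}} (hP : IsPrimary P) {A : C}
    (α β : Fib P A) : Fib P A := (hP.exists_meet α β).choose

/-- The finite meet `⋀_{i ∈ s} φ_i` in a fiber of a primary doctrine. -/
noncomputable def IsPrimary.bigMeet {P : Cᵒᵖ ⥤ PartOrd.{w}} (hP : IsPrimary P) {A : C} {ι : Type x}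
    (s : Finset ι) (φ : ι → Fib P A) : Fib P A := (hP.exists_bigMeet s φ).choose

/-- The implication `α → β` in a fiber of an implicational doctrine. -/
noncomputable def IsImplicational.imp {P : Cᵒᵖ ⥤ PartOrd.{w}} (hP : IsImplicational P) {A : C}
    (α β : Fib P A) : Fib P A := (hP.exists_imp α β).choose

/-- The element `∃^B_D α` of an existential doctrine. -/
noncomputable def IsExistential.ex [CartesianMonoidalCategory C] {P : Cᵒᵖ ⥤ PartOrd.{w}} (hP : IsExistential P) {D B : C}
    (α : Fib P (D ⊗ B)) : Fib P D := (hP.exists_ex α).choose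

variable {P : Cᵒᵖ ⥤ PartOrd.{w}} (hP : IsPrimary P) {A B : C}

theorem IsPrimary.meet_isGLB (α β : Fib P A) : IsGLB {α, β} (hP.meet α β) :=
  (hP.exists_meet α β).choose_spec

theorem IsPrimary.le_meet {α β γ : Fib P A} : γ ≤ hP.meet α β ↔ γ ≤ α ∧ γ ≤ β := by
  rw [le_isGLB_iff (hP.meet_isGLB α β)]
  simp [lowerBounds]

theorem IsPrimary.re_meet_eq (f : A ⟶ B) (α β : Fib P B) :
    re P f (hP.meet α β) = hP.meet (re P f α) (re P f β) :=
  (hP.re_meet f (hP.meet_isGLB α β)).unique (hP.meet_isGLB _ _)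

theorem IsPrimary.bigMeet_isGLB {ι : Type x} (s : Finset ι) (φ : ι → Fib P A) :
    IsGLB (φ '' s) (hP.bigMeet s φ) :=
  (hP.exists_bigMeet s φ).choose_spec

theorem IsPrimary.le_bigMeet {ι : Type x} {s : Finset ι} {φ : ι → Fib P A} {γ : Fib P A} :
    γ ≤ hP.bigMeet s φ ↔ ∀ i ∈ s, γ ≤ φ i := by
  rw [le_isGLB_iff (hP.bigMeet_isGLB s φ)]
  simp [lowerBounds]

theorem IsPrimary.bigMeet_anti {ι : Type x} {s t : Finset ι} (h : s ⊆ t) (φ : ι → Fib P A) :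
    hP.bigMeet t φ ≤ hP.bigMeet s φ :=
  hP.le_bigMeet.2 fun i hi => hP.le_bigMeet.1 le_rfl i (h hi)

end Operations

section Morphisms

variable {C : Type u} [Category.{v} C] [CartesianMonoidalCategory C]
  {D : Type u₂} [Category.{v₂} D] [CartesianMonoidalCategory D]
  {E : Type u₃} [Category.{v₃} E] [CartesianMonoidalCategory E]

/-- A morphism of doctrines `(F, 𝔣) : P → R`: a functor `F` preserving finite products and a
natural transformation `𝔣 : P ⟶ R ∘ Fᵒᵖ`. -/
structure DoctrineHom (P : Cᵒᵖ ⥤ PartOrd.{w}) (R : Dᵒᵖ ⥤ PartOrd.{w₂}) where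
  functor : C ⥤ D
  preservesFiniteProducts : PreservesFiniteProducts functor
  app : ∀ A : C, Fib P A →o Fib R (functor.obj A)
  naturality : ∀ {A B : C} (f : A ⟶ B) (β : Fib P B),
    app A (re P f β) = re R (functor.map f) (app B β)

namespace DoctrineHom

attribute [instance] preservesFiniteProducts

variable {P : Cᵒᵖ ⥤ PartOrd.{w}} {R : Dᵒᵖ ⥤ PartOrd.{w₂}} {S : Eᵒᵖ ⥤ PartOrd.{w₃}}

/-- Composition of morphisms of doctrines. -/
def comp (F : DoctrineHom P R) (G : DoctrineHom R S) : DoctrineHom P S where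
  functor := F.functor ⋙ G.functor
  preservesFiniteProducts := inferInstance
  app A := (G.app (F.functor.obj A)).comp (F.app A)
  naturality f β := by simp [F.naturality, G.naturality]

/-- For `α ∈ P(A × B)`, the element `𝔣(α)` seen in `R(FA × FB)` along the canonical isomorphism
`F(A × B) ≅ FA × FB`. -/
noncomputable def appProd (F : DoctrineHom P R) {A B : C} (α : Fib P (A ⊗ B)) :
    Fib R (F.functor.obj A ⊗ F.functor.obj B) :=
  re R (inv (CartesianMonoidalCategory.prodComparison F.functor A B)) (F.app (A ⊗ B) α)

variable (F : DoctrineHom P R)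

/-- `P`, `R` are primary and `𝔣` preserves finite meets. -/
structure IsPrimary : Prop where
  source : RichDoctrine.IsPrimary P
  target : RichDoctrine.IsPrimary R
  top : ∀ {A : C} {t : Fib P A}, IsTop t → IsTop (F.app A t)
  meet : ∀ {A : C} {α β m : Fib P A}, IsGLB {α, β} m → IsGLB {F.app A α, F.app A β} (F.app A m)

/-- `P`, `R` are implicational and `𝔣` preserves finite meets and implications. -/
structure IsImplicational : Prop where
  source : RichDoctrine.IsImplicational P
  target : RichDoctrine.IsImplicational R
  primary : F.IsPrimary
  imp : ∀ {A : C} {α β i : Fib P A}, IsImp α β i → IsImp (F.app A α) (F.app A β) (F.app A i)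

/-- `P`, `R` are existential and `𝔣` preserves finite meets and existential quantifiers. -/
structure IsExistential : Prop where
  source : RichDoctrine.IsExistential P
  target : RichDoctrine.IsExistential R
  primary : F.IsPrimary
  ex : ∀ {A B : C} {α : Fib P (A ⊗ B)} {e : Fib P A}, IsEx P α e → IsEx R (F.appProd α) (F.app A e)

/-- `P`, `R` are universal and `𝔣` preserves universal quantifiers. -/
structure IsUniversal : Prop where
  source : RichDoctrine.IsUniversal P
  target : RichDoctrine.IsUniversal R
  all : ∀ {A B : C} {α : Fib P (A ⊗ B)} {e : Fib P A}, IsAll P α e →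
    IsAll R (F.appProd α) (F.app A e)

/-- `P`, `R` are bounded and `𝔣` preserves top and bottom elements. -/
structure IsBounded : Prop where
  source : RichDoctrine.IsBounded P
  target : RichDoctrine.IsBounded R
  top : ∀ {A : C} {t : Fib P A}, IsTop t → IsTop (F.app A t)
  bot : ∀ {A : C} {b : Fib P A}, IsBot b → IsBot (F.app A b)

/-- `P`, `R` are elementary and `𝔣` preserves finite meets and fibered equality. -/
structure IsElementary : Prop where
  source : RichDoctrine.IsElementary P
  target : RichDoctrine.IsElementary R
  primary : F.IsPrimary
  eq : ∀ {δ : ∀ A : C, Fib P (A ⊗ A)} {ε : ∀ B : D, Fib R (B ⊗ B)}, IsFiberedEq P δ →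
    IsFiberedEq R ε → ∀ A : C, F.appProd (δ A) = ε (F.functor.obj A)

end DoctrineHom

end Morphisms

section Contexts

variable (C : Type u) (Λ : Type x)

/-- The finite lists `X̄ = ((X₁, x₁), …, (Xₙ, xₙ))` with distinct entries in `ob C × Λ`. -/
def Ctx : Type (max u x) := {l : List (C × Λ) // l.Nodup}

variable {C Λ}

/-- `X̄ ≤ Ȳ` iff every entry of `X̄` is an entry of `Ȳ`. -/
instance : Preorder (Ctx C Λ) where
  le X Y := ∀ y ∈ X.1, y ∈ Y.1
  le_refl _ _ h := h
  le_trans _ _ _ h₁ h₂ y hy := h₂ y (h₁ y hy)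

namespace Ctx

/-- The empty list. -/
def empty : Ctx C Λ := ⟨[], List.nodup_nil⟩

theorem empty_le (X : Ctx C Λ) : (empty : Ctx C Λ) ≤ X := fun _ h => absurd h List.not_mem_nil

open Classical in
/-- The list `X̄` together with the entries of `Ȳ`. -/
noncomputable def join (X Y : Ctx C Λ) : Ctx C Λ := ⟨X.1 ∪ Y.1, List.Nodup.union _ Y.2⟩

open Classical in
theorem le_left (X Y : Ctx C Λ) : X ≤ X.join Y := fun _ h => by simp [join, h]

open Classical in
theorem le_right (X Y : Ctx C Λ) : Y ≤ X.join Y := fun _ h => by simp [join, h]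

open Classical in
theorem join_le {X Y Z : Ctx C Λ} (h : X ≤ Z) (h' : Y ≤ Z) : X.join Y ≤ Z := fun y hy => by
  rcases List.mem_union_iff.1 hy with hy | hy
  exacts [h y hy, h' y hy]

/-- The list `X̄` with the new entry `y` added at the end. -/
def snoc (X : Ctx C Λ) (y : C × Λ) (h : y ∉ X.1) : Ctx C Λ :=
  ⟨X.1 ++ [y], by
    rw [List.nodup_append]
    exact ⟨X.2, List.nodup_singleton y, fun a ha b hb e => h (by simp_all)⟩⟩

theorem le_snoc (X : Ctx C Λ) (y : C × Λ) (h : y ∉ X.1) : X ≤ X.snoc y h :=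
  fun _ hz => List.mem_append_left _ hz

variable [Category.{v} C] [CartesianMonoidalCategory C]

instance finite_entries (X : Ctx C Λ) : Finite {y // y ∈ X.1} := List.finite_toSet X.1

/-- The product `ΠX̄ = X₁ × ⋯ × Xₙ`. It is indexed by the entries of `X̄` (which are distinct), so that the
induced function `τ` between the positions for `X̄ ≤ Ȳ` is the identity on entries. -/
noncomputable def prod (X : Ctx C Λ) : C := ∏ᶜ fun y : {y // y ∈ X.1} => y.1.1

/-- The projection from `ΠX̄` to the component of an entry of `X̄`. -/
noncomputable def proj (X : Ctx C Λ) (y : C × Λ) (h : y ∈ X.1) : X.prod ⟶ y.1 :=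
  Pi.π (fun y : {y // y ∈ X.1} => y.1.1) ⟨y, h⟩

/-- For `X̄ ≤ Ȳ`, the projection `⟨pr_{τ(1)}, …, pr_{τ(n)}⟩ : ΠȲ ⟶ ΠX̄`. -/
noncomputable def restr {X Y : Ctx C Λ} (h : X ≤ Y) : Y.prod ⟶ X.prod :=
  Pi.lift fun y => Y.proj y.1 (h y.1 y.2)

@[ext] theorem prod_hom_ext {X : Ctx C Λ} {A : C} {f g : A ⟶ X.prod}
    (h : ∀ y hy, f ≫ X.proj y hy = g ≫ X.proj y hy) : f = g :=
  Pi.hom_ext _ _ fun y => h y.1 y.2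

@[simp] theorem restr_proj {X Y : Ctx C Λ} (h : X ≤ Y) (y : C × Λ)
    (hy : y ∈ X.1) : restr h ≫ X.proj y hy = Y.proj y (h y hy) :=
  Pi.lift_π (fun z : {z // z ∈ X.1} => Y.proj z.1 (h z.1 z.2)) ⟨y, hy⟩

@[simp] theorem restr_self (X : Ctx C Λ) (h : X ≤ X) : restr h = 𝟙 X.prod := by
  ext; simp

@[simp] theorem restr_restr {X Y Z : Ctx C Λ} (h : X ≤ Y) (h' : Y ≤ Z) :
    restr h' ≫ restr h = restr (h.trans h') := by
  ext; simp

end Ctx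

end Contexts

section ConstBase

/-- The base category `C̲` of `P̲`: the same objects as `C`; an arrow `A ⇢ B` is the class of a
`C`-arrow `ΠX̄ × A ⟶ B`. -/
structure ConstBase (C : Type u) (Λ : Type x) : Type u where
  of : C

variable {C : Type u} {Λ : Type x} [Category.{v} C] [CartesianMonoidalCategory C]

/-- A representative `(f, X̄)` with `f : ΠX̄ × A ⟶ B` of an arrow of `C̲`. -/
structure ArrRep (Λ : Type x) (A B : C) : Type (max u v x) where
  ctx : Ctx C Λ
  arr : ctx.prod ⊗ A ⟶ B

namespace ArrRep

/-- The composite of `f` with `ΠZ̄ × A ⟶ ΠX̄ × A`, for `X̄ ≤ Z̄`. -/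
noncomputable def extend {A B : C} (f : ArrRep Λ A B) {Z : Ctx C Λ} (h : f.ctx ≤ Z) :
    Z.prod ⊗ A ⟶ B :=
  Ctx.restr h ▷ A ≫ f.arr

theorem restr_extend {A B : C} (f : ArrRep Λ A B) {Z W : Ctx C Λ} (h : f.ctx ≤ Z) (k : Z ≤ W) :
    Ctx.restr k ▷ A ≫ f.extend h = f.extend (h.trans k) := by
  simp only [extend, ← comp_whiskerRight_assoc, Ctx.restr_restr]

/-- `[f, X̄] = [g, Ȳ]` iff `f` and `g` agree over some `Z̄ ≥ X̄, Ȳ`. -/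
def Rel {A B : C} (f g : ArrRep Λ A B) : Prop :=
  ∃ (Z : Ctx C Λ) (hf : f.ctx ≤ Z) (hg : g.ctx ≤ Z), f.extend hf = g.extend hg

theorem extend_eq_of_le {A B : C} {f g : ArrRep Λ A B} {Z W : Ctx C Λ} {hf : f.ctx ≤ Z}
    {hg : g.ctx ≤ Z} (e : f.extend hf = g.extend hg) (h : Z ≤ W) :
    f.extend (hf.trans h) = g.extend (hg.trans h) := by
  rw [← restr_extend f hf h, ← restr_extend g hg h, e]

instance setoid (A B : C) : Setoid (ArrRep Λ A B) where
  r := Rel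
  iseqv :=
    { refl := fun f => ⟨f.ctx, le_rfl, le_rfl, rfl⟩
      symm := fun ⟨Z, h, k, e⟩ => ⟨Z, k, h, e.symm⟩
      trans := fun ⟨Z, h, _, e⟩ ⟨W, _, k, e'⟩ =>
        ⟨Z.join W, h.trans (Z.le_left W), k.trans (Z.le_right W),
          (extend_eq_of_le e (Z.le_left W)).trans (extend_eq_of_le e' (Z.le_right W))⟩ }

/-- Over a common context, the composite of `f` and `g` is `g ∘ ⟨pr, f⟩`. -/
noncomputable def comp {A B D : C} (f : ArrRep Λ A B) (g : ArrRep Λ B D) : ArrRep Λ A D where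
  ctx := f.ctx.join g.ctx
  arr := lift (fst _ _) (f.extend (f.ctx.le_left g.ctx)) ≫ g.extend (f.ctx.le_right g.ctx)

theorem left_le_comp {A B D : C} (f : ArrRep Λ A B) (g : ArrRep Λ B D) :
    f.ctx ≤ (f.comp g).ctx := Ctx.le_left _ _

theorem right_le_comp {A B D : C} (f : ArrRep Λ A B) (g : ArrRep Λ B D) :
    g.ctx ≤ (f.comp g).ctx := Ctx.le_right _ _

theorem comp_le {A B D : C} {f : ArrRep Λ A B} {g : ArrRep Λ B D} {Z : Ctx C Λ}
    (h : f.ctx ≤ Z) (k : g.ctx ≤ Z) : (f.comp g).ctx ≤ Z := Ctx.join_le h k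

theorem comp_extend {A B D : C} (f : ArrRep Λ A B) (g : ArrRep Λ B D) {Z : Ctx C Λ}
    (h : (f.comp g).ctx ≤ Z) :
    (f.comp g).extend h =
      lift (fst _ _) (f.extend ((left_le_comp f g).trans h)) ≫
        g.extend ((right_le_comp f g).trans h) := by
  rw [← restr_extend f (Ctx.le_left f.ctx g.ctx) h, ← restr_extend g (Ctx.le_right f.ctx g.ctx) h]
  simp only [extend, comp, comp_lift_assoc, lift_whiskerRight_assoc, whiskerRight_fst_assoc,
    Category.assoc]

theorem comp_congr {A B D : C} {f f' : ArrRep Λ A B} {g g' : ArrRep Λ B D}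
    (hf : f ≈ f') (hg : g ≈ g') : f.comp g ≈ f'.comp g' := by
  obtain ⟨Z, h, h', e⟩ := hf
  obtain ⟨W, k, k', e'⟩ := hg
  refine ⟨Z.join W, comp_le (h.trans (Z.le_left W)) (k.trans (Z.le_right W)),
    comp_le (h'.trans (Z.le_left W)) (k'.trans (Z.le_right W)), ?_⟩
  rw [comp_extend, comp_extend, extend_eq_of_le e (Z.le_left W), extend_eq_of_le e' (Z.le_right W)]

/-- A `C`-arrow `f : A ⟶ B`, seen in the empty context. -/
noncomputable def const (Λ : Type x) {A B : C} (f : A ⟶ B) : ArrRep Λ A B := ⟨Ctx.empty, snd _ _ ≫ f⟩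

theorem const_le {A B : C} (f : A ⟶ B) (Z : Ctx C Λ) : (const Λ f).ctx ≤ Z := Ctx.empty_le Z

theorem const_extend {A B : C} (f : A ⟶ B) {Z : Ctx C Λ} (h : (const Λ f).ctx ≤ Z) :
    (const Λ f).extend h = snd _ _ ≫ f := by
  simp [const, extend]

theorem comp_const_extend {A B D : C} (f : ArrRep Λ A B) (g : B ⟶ D) {Z : Ctx C Λ}
    (h : (f.comp (const Λ g)).ctx ≤ Z) :
    (f.comp (const Λ g)).extend h = f.extend ((left_le_comp f (const Λ g)).trans h) ≫ g := by
  simp [comp_extend, const_extend]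

/-- The pairing `⟨f, g⟩`, over a common context. -/
noncomputable def pair {A B D : C} (f : ArrRep Λ A B) (g : ArrRep Λ A D) :
    ArrRep Λ A (B ⊗ D) where
  ctx := f.ctx.join g.ctx
  arr := lift (f.extend (f.ctx.le_left g.ctx)) (g.extend (f.ctx.le_right g.ctx))

theorem left_le_pair {A B D : C} (f : ArrRep Λ A B) (g : ArrRep Λ A D) :
    f.ctx ≤ (f.pair g).ctx := Ctx.le_left _ _

theorem right_le_pair {A B D : C} (f : ArrRep Λ A B) (g : ArrRep Λ A D) :
    g.ctx ≤ (f.pair g).ctx := Ctx.le_right _ _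

theorem pair_extend {A B D : C} (f : ArrRep Λ A B) (g : ArrRep Λ A D) {Z : Ctx C Λ}
    (h : (pair f g).ctx ≤ Z) :
    (pair f g).extend h = lift (f.extend ((left_le_pair f g).trans h))
      (g.extend ((right_le_pair f g).trans h)) := by
  rw [← ArrRep.restr_extend f (Ctx.le_left f.ctx g.ctx) h,
    ← ArrRep.restr_extend g (Ctx.le_right f.ctx g.ctx) h]
  simp [ArrRep.extend, pair]

end ArrRep

noncomputable instance : Category.{max u v x} (ConstBase C Λ) where
  Hom A B := Quotient (ArrRep.setoid (Λ := Λ) A.of B.of)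
  id A := ⟦ArrRep.const Λ (𝟙 A.of)⟧
  comp := Quotient.map₂ ArrRep.comp fun _ _ hf _ _ hg => ArrRep.comp_congr hf hg
  id_comp := by
    rintro A B ⟨f⟩
    refine Quotient.sound ⟨_, le_rfl, ArrRep.right_le_comp _ _, ?_⟩
    simp [ArrRep.comp_extend, ArrRep.const_extend]
  comp_id := by
    rintro A B ⟨f⟩
    refine Quotient.sound ⟨_, le_rfl, ArrRep.left_le_comp _ _, ?_⟩
    simp [ArrRep.comp_extend, ArrRep.const_extend]
  assoc := by
    rintro A B D E ⟨f⟩ ⟨g⟩ ⟨h⟩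
    refine Quotient.sound ⟨_, le_rfl,
      ArrRep.comp_le ((ArrRep.left_le_comp _ _).trans (ArrRep.left_le_comp _ _))
        (ArrRep.comp_le ((ArrRep.right_le_comp _ _).trans (ArrRep.left_le_comp _ _))
          (ArrRep.right_le_comp _ _)), ?_⟩
    simp [ArrRep.comp_extend, comp_lift_assoc]

namespace ConstBase

/-- The class `[f, X̄] : A ⇢ B`. -/
noncomputable def cls {A B : ConstBase C Λ} (f : ArrRep Λ A.of B.of) : A ⟶ B := Quotient.mk _ f

theorem cls_comp {A B D : ConstBase C Λ} (f : ArrRep Λ A.of B.of) (g : ArrRep Λ B.of D.of) :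
    (cls f ≫ cls g : A ⟶ D) = cls (f.comp g) := rfl

theorem id_eq (A : ConstBase C Λ) : 𝟙 A = cls (ArrRep.const Λ (𝟙 A.of)) := rfl

theorem cls_eq {A B : ConstBase C Λ} {f g : ArrRep Λ A.of B.of} {Z : Ctx C Λ} (hf : f.ctx ≤ Z)
    (hg : g.ctx ≤ Z) (e : f.extend hf = g.extend hg) : (cls f : A ⟶ B) = cls g :=
  Quotient.sound ⟨Z, hf, hg, e⟩

theorem cls_eq_iff {A B : ConstBase C Λ} {f g : ArrRep Λ A.of B.of} : (cls f : A ⟶ B) = cls g ↔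
    ∃ (Z : Ctx C Λ) (hf : f.ctx ≤ Z) (hg : g.ctx ≤ Z), f.extend hf = g.extend hg :=
  Quotient.eq

theorem exists_cls {A B : ConstBase C Λ} (f : A ⟶ B) : ∃ g, f = cls g :=
  (Quotient.exists_rep f).imp fun _ h => h.symm

/-- The functor `C ⥤ C̲`, the identity on objects, `f ↦ [f, ∅]` on arrows. -/
noncomputable def incl (C : Type u) [Category.{v} C] [CartesianMonoidalCategory C] (Λ : Type x) :
    C ⥤ ConstBase C Λ where
  obj A := ⟨A⟩
  map f := cls (ArrRep.const Λ f)
  map_id _ := rfl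
  map_comp f g := cls_eq (ArrRep.const_le _ _) le_rfl (by
    simp [ArrRep.comp_extend, ArrRep.const_extend])

/-- The terminal object of `C̲` is that of `C`. -/
noncomputable def terminalCone : LimitCone (Functor.empty.{0} (ConstBase C Λ)) where
  cone := asEmptyCone ⟨𝟙_ C⟩
  isLimit := IsTerminal.ofUniqueHom (fun A => (incl C Λ).map (toUnit A.of)) (by
    rintro A f
    obtain ⟨f, rfl⟩ := exists_cls f
    exact cls_eq le_rfl (ArrRep.const_le _ _) (toUnit_unique _ _))

theorem pair_fst {A B D : ConstBase C Λ} (f : ArrRep Λ A.of B.of) (g : ArrRep Λ A.of D.of) :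
    (cls (f.pair g) : A ⟶ ⟨B.of ⊗ D.of⟩) ≫ (incl C Λ).map (fst B.of D.of) = cls f :=
  cls_eq le_rfl ((f.left_le_pair g).trans (ArrRep.left_le_comp (f.pair g) _))
    ((ArrRep.comp_const_extend _ _ _).trans ((congrArg (· ≫ fst B.of D.of) (ArrRep.pair_extend f g _)).trans (lift_fst _ _)))

theorem pair_snd {A B D : ConstBase C Λ} (f : ArrRep Λ A.of B.of) (g : ArrRep Λ A.of D.of) :
    (cls (f.pair g) : A ⟶ ⟨B.of ⊗ D.of⟩) ≫ (incl C Λ).map (snd B.of D.of) = cls g :=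
  cls_eq le_rfl ((f.right_le_pair g).trans (ArrRep.left_le_comp (f.pair g) _))
    ((ArrRep.comp_const_extend _ _ _).trans ((congrArg (· ≫ snd B.of D.of) (ArrRep.pair_extend f g _)).trans (lift_snd _ _)))

theorem prod_ext {A B D : ConstBase C Λ} {f g : A ⟶ ⟨B.of ⊗ D.of⟩}
    (h₁ : f ≫ (incl C Λ).map (fst B.of D.of) = g ≫ (incl C Λ).map (fst B.of D.of))
    (h₂ : f ≫ (incl C Λ).map (snd B.of D.of) = g ≫ (incl C Λ).map (snd B.of D.of)) : f = g := by
  obtain ⟨f, rfl⟩ := exists_cls f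
  obtain ⟨g, rfl⟩ := exists_cls g
  obtain ⟨Z, hf, hg, e⟩ := cls_eq_iff.1 h₁
  obtain ⟨W, kf, kg, e'⟩ := cls_eq_iff.1 h₂
  have e := ArrRep.extend_eq_of_le e (Z.le_left W)
  have e' := ArrRep.extend_eq_of_le e' (Z.le_right W)
  exact cls_eq _ _ (CartesianMonoidalCategory.hom_ext _ _
    ((ArrRep.comp_const_extend f _ _).symm.trans (e.trans (ArrRep.comp_const_extend g _ _)))
    ((ArrRep.comp_const_extend f _ _).symm.trans (e'.trans (ArrRep.comp_const_extend g _ _))))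

/-- The binary products of `C̲` are those of `C`, with the classes of the projections. -/
noncomputable def prodCone (A B : ConstBase C Λ) : LimitCone (pair A B) where
  cone := BinaryFan.mk (P := (⟨A.of ⊗ B.of⟩ : ConstBase C Λ)) ((incl C Λ).map (fst A.of B.of))
    ((incl C Λ).map (snd A.of B.of))
  isLimit := BinaryFan.isLimitMk
    (fun s => cls (ArrRep.pair (Quotient.out s.fst) (Quotient.out s.snd)))
    (fun s => (pair_fst _ _).trans (Quotient.out_eq s.fst))
    (fun s => (pair_snd _ _).trans (Quotient.out_eq s.snd))
    (fun s _ h₁ h₂ => prod_ext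
      (h₁.trans ((pair_fst _ _).trans (Quotient.out_eq s.fst)).symm)
      (h₂.trans ((pair_snd _ _).trans (Quotient.out_eq s.snd)).symm))

noncomputable instance : CartesianMonoidalCategory (ConstBase C Λ) :=
  .ofChosenFiniteProducts terminalCone prodCone

instance : PreservesFiniteProducts (incl C Λ) := by
  have h₁ : PreservesLimit (Functor.empty.{0} C) (incl C Λ) :=
    preservesLimit_of_preserves_limit_cone isTerminalTensorUnit
     ((isLimitMapConeEmptyConeEquiv (incl C Λ) _).symm terminalCone.isLimit)
  have : PreservesLimitsOfShape (Discrete.{0} PEmpty) (incl C Λ) :=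
    preservesLimitsOfShape_pempty_of_preservesTerminal _
  have : PreservesLimitsOfShape (Discrete WalkingPair) (incl C Λ) := ⟨fun {K} => by
    have : PreservesLimit (Limits.pair (K.obj ⟨.left⟩) (K.obj ⟨.right⟩)) (incl C Λ) :=
      preservesLimit_of_preserves_limit_cone (tensorProductIsBinaryProduct _ _)
        ((isLimitMapConeBinaryFanEquiv (incl C Λ) _ _).symm
          (prodCone ⟨K.obj ⟨.left⟩⟩ ⟨K.obj ⟨.right⟩⟩).isLimit)
    exact preservesLimit_of_iso_diagram _ (diagramIsoPair K).symm⟩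
  exact .of_preserves_binary_and_terminal _

end ConstBase

end ConstBase
section AddConst

variable {C : Type u} [Category.{v} C] [CartesianMonoidalCategory C]

/-- A representative `(φ, X̄)` with `φ ∈ P(ΠX̄ × A)`. -/
structure FormRep (P : Cᵒᵖ ⥤ PartOrd.{w}) (Λ : Type x) (A : C) : Type (max u w x) where
  ctx : Ctx C Λ
  form : Fib P (ctx.prod ⊗ A)

namespace FormRep

variable {P : Cᵒᵖ ⥤ PartOrd.{w}} {Λ : Type x}

/-- The reindexing of `φ` to `P(ΠZ̄ × A)`, for `X̄ ≤ Z̄`. -/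
noncomputable def extend {A : C} (φ : FormRep P Λ A) {Z : Ctx C Λ} (h : φ.ctx ≤ Z) :
    Fib P (Z.prod ⊗ A) :=
  re P (Ctx.restr h ▷ A) φ.form

theorem re_extend {A : C} (φ : FormRep P Λ A) {Z W : Ctx C Λ} (h : φ.ctx ≤ Z) (k : Z ≤ W) :
    re P (Ctx.restr k ▷ A) (φ.extend h) = φ.extend (h.trans k) := by
  simp only [extend, ← re_comp, ← comp_whiskerRight, Ctx.restr_restr]

theorem extend_mono {A : C} {φ ψ : FormRep P Λ A} {Z W : Ctx C Λ} {hφ : φ.ctx ≤ Z}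
    {hψ : ψ.ctx ≤ Z} (e : φ.extend hφ ≤ ψ.extend hψ) (h : Z ≤ W) :
    φ.extend (hφ.trans h) ≤ ψ.extend (hψ.trans h) := by
  rw [← re_extend φ hφ h, ← re_extend ψ hψ h]
  exact (re P _).monotone e

instance (A : C) : Preorder (FormRep P Λ A) where
  le φ ψ := ∃ (Z : Ctx C Λ) (hφ : φ.ctx ≤ Z) (hψ : ψ.ctx ≤ Z), φ.extend hφ ≤ ψ.extend hψ
  le_refl φ := ⟨φ.ctx, le_rfl, le_rfl, le_rfl⟩
  le_trans := fun _ _ _ ⟨Z, h, _, e⟩ ⟨W, _, k, e'⟩ =>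
    ⟨Z.join W, h.trans (Z.le_left W), k.trans (Z.le_right W),
      (extend_mono e (Z.le_left W)).trans (extend_mono e' (Z.le_right W))⟩

/-- `P̲([f, X̄])(ψ, Ȳ) = P(⟨pr, f⟩)ψ` over the context `X̄ ∪ Ȳ`. -/
noncomputable def reindex {A B : C} (f : ArrRep Λ A B) (ψ : FormRep P Λ B) : FormRep P Λ A where
  ctx := f.ctx.join ψ.ctx
  form := re P (lift (fst _ _) (f.extend (f.ctx.le_left ψ.ctx))) (ψ.extend (f.ctx.le_right ψ.ctx))

theorem left_le_reindex {A B : C} (f : ArrRep Λ A B) (ψ : FormRep P Λ B) :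
    f.ctx ≤ (reindex f ψ).ctx := Ctx.le_left _ _

theorem right_le_reindex {A B : C} (f : ArrRep Λ A B) (ψ : FormRep P Λ B) :
    ψ.ctx ≤ (reindex f ψ).ctx := Ctx.le_right _ _

theorem reindex_le {A B : C} {f : ArrRep Λ A B} {ψ : FormRep P Λ B} {Z : Ctx C Λ}
    (h : f.ctx ≤ Z) (k : ψ.ctx ≤ Z) : (reindex f ψ).ctx ≤ Z := Ctx.join_le h k

theorem reindex_extend {A B : C} (f : ArrRep Λ A B) (ψ : FormRep P Λ B) {Z : Ctx C Λ}
    (h : (reindex f ψ).ctx ≤ Z) :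
    (reindex f ψ).extend h = re P (lift (fst _ _) (f.extend ((left_le_reindex f ψ).trans h)))
      (ψ.extend ((right_le_reindex f ψ).trans h)) := by
  rw [← ArrRep.restr_extend f (Ctx.le_left f.ctx ψ.ctx) h,
    ← re_extend ψ (Ctx.le_right f.ctx ψ.ctx) h]
  change re P (Ctx.restr (X := f.ctx.join ψ.ctx) h ▷ A)
    (re P (lift (fst _ _) (f.extend (f.ctx.le_left ψ.ctx))) (ψ.extend (f.ctx.le_right ψ.ctx))) = _
  rw [← re_comp, ← re_comp, comp_lift, lift_whiskerRight, whiskerRight_fst]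

theorem reindex_mono {A B : C} {f g : ArrRep Λ A B} {φ ψ : FormRep P Λ B} (h : f ≈ g)
    (k : φ ≤ ψ) : reindex f φ ≤ reindex g ψ := by
  obtain ⟨Z, hf, hg, e⟩ := h
  obtain ⟨W, kφ, kψ, e'⟩ := k
  refine ⟨Z.join W, reindex_le (hf.trans (Z.le_left W)) (kφ.trans (Z.le_right W)),
    reindex_le (hg.trans (Z.le_left W)) (kψ.trans (Z.le_right W)), ?_⟩
  rw [reindex_extend, reindex_extend, ArrRep.extend_eq_of_le e (Z.le_left W)]
  exact (re P _).monotone (extend_mono e' (Z.le_right W))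

/-- An element `α ∈ P(A)`, seen in the empty context. -/
noncomputable def const (Λ : Type x) {A : C} (α : Fib P A) : FormRep P Λ A :=
  ⟨Ctx.empty, re P (snd _ _) α⟩

theorem const_le {A : C} (α : Fib P A) (Z : Ctx C Λ) : (const Λ α).ctx ≤ Z := Ctx.empty_le Z

theorem const_extend {A : C} (α : Fib P A) {Z : Ctx C Λ} (h : (const Λ α).ctx ≤ Z) :
    (const Λ α).extend h = re P (snd _ _) α := by
  change re P (Ctx.restr (X := Ctx.empty) h ▷ A) (re P (snd _ _) α) = _
  rw [← re_comp, whiskerRight_snd]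

/-- Two representatives with the same extension to some common context have the same class. -/
theorem class_eq {A : C} {φ ψ : FormRep P Λ A} (Z : Ctx C Λ) (h : φ.ctx ≤ Z) (k : ψ.ctx ≤ Z)
    (e : φ.extend h = ψ.extend k) :
    toAntisymmetrization (· ≤ ·) φ = toAntisymmetrization (· ≤ ·) ψ :=
  Quotient.sound ⟨⟨Z, h, k, e.le⟩, ⟨Z, k, h, e.ge⟩⟩

theorem class_eq_iff {A : C} {φ ψ : FormRep P Λ A} :
    toAntisymmetrization (· ≤ ·) φ = toAntisymmetrization (· ≤ ·) ψ ↔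
      ∃ (Z : Ctx C Λ) (h : φ.ctx ≤ Z) (k : ψ.ctx ≤ Z), φ.extend h = ψ.extend k := by
  refine ⟨fun e => ?_, fun ⟨Z, h, k, e⟩ => class_eq Z h k e⟩
  obtain ⟨⟨Z, h, k, e⟩, ⟨W, k', h', e'⟩⟩ := Quotient.exact e
  exact ⟨Z.join W, h.trans (Z.le_left W), k.trans (Z.le_left W),
    (extend_mono e (Z.le_left W)).antisymm (extend_mono e' (Z.le_right W))⟩

theorem reindex_id {A : C} (φ : FormRep P Λ A) :
    toAntisymmetrization (· ≤ ·) (reindex (ArrRep.const Λ (𝟙 A)) φ) =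
      toAntisymmetrization (· ≤ ·) φ :=
  class_eq _ le_rfl (right_le_reindex _ _) (by
    rw [reindex_extend, ArrRep.const_extend, Category.comp_id, lift_fst_snd, re_id])

theorem reindex_comp {A B D : C} (f : ArrRep Λ A B) (g : ArrRep Λ B D) (φ : FormRep P Λ D) :
    toAntisymmetrization (· ≤ ·) (reindex (f.comp g) φ) =
      toAntisymmetrization (· ≤ ·) (reindex f (reindex g φ)) :=
  class_eq _ le_rfl (reindex_le ((f.left_le_comp g).trans (left_le_reindex _ _))
    (reindex_le ((f.right_le_comp g).trans (left_le_reindex _ _)) (right_le_reindex _ _))) (by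
    simp only [reindex_extend, ArrRep.comp_extend, ← re_comp, comp_lift, lift_fst])

theorem const_mono {A : C} {α β : Fib P A} (h : α ≤ β) : const Λ α ≤ const Λ β :=
  ⟨Ctx.empty, const_le _ _, const_le _ _, by
    rw [const_extend, const_extend]
    exact (re P _).monotone h⟩

theorem reindex_const {A B : C} (f : A ⟶ B) (β : Fib P B) :
    toAntisymmetrization (· ≤ ·) (const Λ (re P f β)) =
      toAntisymmetrization (· ≤ ·) (reindex (ArrRep.const Λ f) (const Λ β)) :=
  class_eq _ (const_le _ _) le_rfl (by
    rw [reindex_extend, ArrRep.const_extend, const_extend, const_extend,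
      ← re_comp, ← re_comp, lift_snd])

/-- The meet of two representatives, over a common context. -/
noncomputable def meet (hP : IsPrimary P) {A : C} (φ ψ : FormRep P Λ A) : FormRep P Λ A where
  ctx := φ.ctx.join ψ.ctx
  form := hP.meet (φ.extend (φ.ctx.le_left ψ.ctx)) (ψ.extend (φ.ctx.le_right ψ.ctx))

section Meet

variable (hP : IsPrimary P) {A B : C} (φ ψ : FormRep P Λ A)

theorem left_le_meet : φ.ctx ≤ (φ.meet hP ψ).ctx := Ctx.le_left _ _

theorem right_le_meet : ψ.ctx ≤ (φ.meet hP ψ).ctx := Ctx.le_right _ _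

theorem meet_ctx_le {φ ψ : FormRep P Λ A} {Z : Ctx C Λ} (h : φ.ctx ≤ Z) (k : ψ.ctx ≤ Z) :
    (φ.meet hP ψ).ctx ≤ Z := Ctx.join_le h k

theorem meet_extend {Z : Ctx C Λ} (h : (φ.meet hP ψ).ctx ≤ Z) :
    (φ.meet hP ψ).extend h =
      hP.meet (φ.extend ((left_le_meet hP φ ψ).trans h))
        (ψ.extend ((right_le_meet hP φ ψ).trans h)) := by
  rw [← re_extend φ (Ctx.le_left φ.ctx ψ.ctx) h, ← re_extend ψ (Ctx.le_right φ.ctx ψ.ctx) h]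
  exact hP.re_meet_eq _ _ _

theorem meet_le_left : φ.meet hP ψ ≤ φ :=
  ⟨_, le_rfl, left_le_meet hP φ ψ, by
    rw [meet_extend]
    exact (hP.le_meet.1 le_rfl).1⟩

theorem meet_le_right : φ.meet hP ψ ≤ ψ :=
  ⟨_, le_rfl, right_le_meet hP φ ψ, by
    rw [meet_extend]
    exact (hP.le_meet.1 le_rfl).2⟩

theorem le_meet {φ ψ γ : FormRep P Λ A} (H : γ ≤ φ) (K : γ ≤ ψ) : γ ≤ φ.meet hP ψ := by
  obtain ⟨Z, h, k, e⟩ := H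
  obtain ⟨W, h', k', e'⟩ := K
  refine ⟨Z.join W, h.trans (Z.le_left W),
    meet_ctx_le hP (k.trans (Z.le_left W)) (k'.trans (Z.le_right W)), ?_⟩
  rw [meet_extend]
  exact hP.le_meet.2 ⟨extend_mono e (Z.le_left W), extend_mono e' (Z.le_right W)⟩

theorem reindex_meet (f : ArrRep Λ B A) :
    toAntisymmetrization (· ≤ ·) (reindex f (φ.meet hP ψ)) =
      toAntisymmetrization (· ≤ ·) ((reindex f φ).meet hP (reindex f ψ)) :=
  class_eq _ le_rfl (meet_ctx_le hP
    (reindex_le (left_le_reindex _ _) ((left_le_meet hP φ ψ).trans (right_le_reindex _ _)))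
    (reindex_le (left_le_reindex _ _) ((right_le_meet hP φ ψ).trans (right_le_reindex _ _)))) (by
    simp only [meet_extend, reindex_extend, hP.re_meet_eq])

end Meet

theorem le_const (hP : IsPrimary P) {A : C} (φ : FormRep P Λ A) {t : Fib P A} (ht : IsTop t) : φ ≤ const Λ t :=
  ⟨φ.ctx, le_rfl, const_le _ _, by
    rw [const_extend]
    exact hP.re_top _ ht _⟩

theorem le_reindex_const (hP : IsPrimary P) {A B : C} (φ : FormRep P Λ A) (f : ArrRep Λ A B) {t : Fib P B} (ht : IsTop t) :
    φ ≤ reindex f (const Λ t) :=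
  ⟨φ.ctx.join f.ctx, φ.ctx.le_left f.ctx, reindex_le (φ.ctx.le_right f.ctx) (const_le _ _), by
    rw [reindex_extend, const_extend, ← re_comp]
    exact hP.re_top _ ht _⟩

end FormRep

/-- The doctrine `P̲ : C̲ᵒᵖ ⥤ Pos`. Its fiber over `A` consists of the classes `[φ, X̄]`, ordered by
`[φ, X̄] ≤ [ψ, Ȳ]` iff `φ ≤ ψ` after reindexing to some common context `Z̄ ≥ X̄, Ȳ`. -/
noncomputable def addConst (P : Cᵒᵖ ⥤ PartOrd.{w}) (Λ : Type x) :
    (ConstBase C Λ)ᵒᵖ ⥤ PartOrd.{max u w x} where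
  obj Y := .of (Antisymmetrization (FormRep P Λ Y.unop.of) (· ≤ ·))
  map f := PartOrd.ofHom (Quotient.lift
    (fun g => OrderHom.antisymmetrization
      ⟨FormRep.reindex g, fun _ _ h => FormRep.reindex_mono (Setoid.refl g) h⟩)
    (fun g g' h => by
      ext φ
      induction φ using Antisymmetrization.ind with
      | _ φ => exact Quotient.sound ⟨FormRep.reindex_mono h le_rfl,
                FormRep.reindex_mono (Setoid.symm h) le_rfl⟩) f.unop)
  map_id _ := by
    ext φ
    induction φ using Antisymmetrization.ind with
    | _ φ => exact FormRep.reindex_id φ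
  map_comp {_ _ _} f g := by
    obtain ⟨f⟩ := f
    obtain ⟨g⟩ := g
    obtain ⟨f, rfl⟩ := ConstBase.exists_cls f
    obtain ⟨g, rfl⟩ := ConstBase.exists_cls g
    ext φ
    induction φ using Antisymmetrization.ind with
    | _ φ => exact FormRep.reindex_comp g f φ

namespace addConst

variable {P : Cᵒᵖ ⥤ PartOrd.{w}} {Λ : Type x}

/-- The class `[φ, X̄]` in the fiber of `P̲` over `A`. -/
noncomputable def cls {A : ConstBase C Λ} (φ : FormRep P Λ A.of) : Fib (addConst P Λ) A :=
  toAntisymmetrization (· ≤ ·) φ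

theorem exists_cls {A : ConstBase C Λ} (α : Fib (addConst P Λ) A) :
    ∃ φ : FormRep P Λ A.of, α = cls φ :=
  (Quotient.exists_rep α).imp fun _ h => h.symm

theorem cls_eq {A : ConstBase C Λ} {φ ψ : FormRep P Λ A.of} {Z : Ctx C Λ} (h : φ.ctx ≤ Z)
    (k : ψ.ctx ≤ Z) (e : φ.extend h = ψ.extend k) :
    (cls φ : Fib (addConst P Λ) A) = cls ψ := FormRep.class_eq Z h k e

theorem cls_le_iff {A : ConstBase C Λ} {φ ψ : FormRep P Λ A.of} :
    (cls φ : Fib (addConst P Λ) A) ≤ cls ψ ↔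
      ∃ (Z : Ctx C Λ) (h : φ.ctx ≤ Z) (k : ψ.ctx ≤ Z), φ.extend h ≤ ψ.extend k := Iff.rfl

theorem re_cls {A B : ConstBase C Λ} (f : ArrRep Λ A.of B.of) (φ : FormRep P Λ B.of) :
    re (addConst P Λ) (ConstBase.cls f : A ⟶ B) (cls φ) = cls (FormRep.reindex f φ) := rfl

end addConst

/-- The morphism `P → P̲`: `f ↦ [f, ∅]` and `α ↦ [α, ∅]`. -/
noncomputable def toConst (P : Cᵒᵖ ⥤ PartOrd.{w}) (Λ : Type x) :
    DoctrineHom P (addConst P Λ) where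
  functor := ConstBase.incl C Λ
  preservesFiniteProducts := inferInstance
  app _ :=
    { toFun := fun α => addConst.cls (FormRep.const Λ α)
      monotone' := fun _ _ h => FormRep.const_mono h }
  naturality f β := FormRep.reindex_const f β

namespace addConst

variable {P : Cᵒᵖ ⥤ PartOrd.{w}} {Λ : Type x} {A : ConstBase C Λ}

theorem meet_isGLB (hP : IsPrimary P) (φ ψ : FormRep P Λ A.of) :
    IsGLB {(cls φ : Fib (addConst P Λ) A), cls ψ} (cls (φ.meet hP ψ)) := by
  refine ⟨?_, fun γ hγ => ?_⟩
  · rintro _ (rfl | rfl)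
    exacts [FormRep.meet_le_left hP φ ψ, FormRep.meet_le_right hP φ ψ]
  · obtain ⟨γ, rfl⟩ := exists_cls γ
    exact FormRep.le_meet hP (hγ (Set.mem_insert _ _)) (hγ (Set.mem_insert_of_mem _ rfl))

theorem top_isTop (hP : IsPrimary P) {t : Fib P A.of} (ht : IsTop t) :
    IsTop (cls (FormRep.const Λ t) : Fib (addConst P Λ) A) := fun γ => by
  obtain ⟨γ, rfl⟩ := exists_cls γ
  exact FormRep.le_const hP γ ht

end addConst

/-- If `P` is primary, so is `P̲`. -/
theorem IsPrimary.addConst {P : Cᵒᵖ ⥤ PartOrd.{w}} (hP : IsPrimary P) (Λ : Type x) :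
    IsPrimary (addConst P Λ) where
  exists_top A := by
    obtain ⟨t, ht⟩ := hP.exists_top A.of
    exact ⟨_, addConst.top_isTop hP ht⟩
  exists_meet α β := by
    obtain ⟨φ, rfl⟩ := addConst.exists_cls α
    obtain ⟨ψ, rfl⟩ := addConst.exists_cls β
    exact ⟨_, addConst.meet_isGLB hP φ ψ⟩
  re_top {_ B} f t ht := by
    obtain ⟨f, rfl⟩ := ConstBase.exists_cls f
    obtain ⟨s, hs⟩ := hP.exists_top B.of
    obtain rfl := (addConst.top_isTop hP hs t).antisymm (ht _)
    intro γ
    obtain ⟨γ, rfl⟩ := addConst.exists_cls γ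
    exact FormRep.le_reindex_const hP γ f hs
  re_meet {A B} f α β m hm := by
    obtain ⟨f, rfl⟩ := ConstBase.exists_cls f
    obtain ⟨φ, rfl⟩ := addConst.exists_cls α
    obtain ⟨ψ, rfl⟩ := addConst.exists_cls β
    obtain rfl := hm.unique (addConst.meet_isGLB hP φ ψ)
    have e : re (RichDoctrine.addConst P Λ) (ConstBase.cls f : A ⟶ B) (addConst.cls (φ.meet hP ψ)) =
        addConst.cls ((FormRep.reindex f φ).meet hP (FormRep.reindex f ψ)) :=
      FormRep.reindex_meet hP φ ψ f
    rw [e]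
    exact addConst.meet_isGLB hP _ _

end AddConst

section AddAxioms

variable {C : Type u} [Category.{v} C] [CartesianMonoidalCategory C] {P : Cᵒᵖ ⥤ PartOrd.{w}}

/-- An element of the fiber over `A` of the doctrine `P^𝒰`, for a finite set `𝒰` of indices of
axioms `ψ_i ∈ P(t)`: an element of `P(A)` below `P(!)⋀_{i ∈ 𝒰} ψ_i`. -/
structure AxRep (hP : IsPrimary P) {ι : Type x} (ψ : ι → Fib P (𝟙_ C)) (A : C) :
    Type (max w x) where
  ax : Finset ι
  form : Fib P A
  le : form ≤ re P (toUnit A) (hP.bigMeet ax ψ)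

namespace AxRep

variable {hP : IsPrimary P} {ι : Type x} {ψ : ι → Fib P (𝟙_ C)}

/-- The image `α ∧ P(!)⋀_{i ∈ 𝒲} ψ_i` of `α` in the fiber of `P^𝒲`. -/
noncomputable def extend {A : C} (α : AxRep hP ψ A) (W : Finset ι) : Fib P A :=
  hP.meet α.form (re P (toUnit A) (hP.bigMeet W ψ))

theorem extend_mono {A : C} {α β : AxRep hP ψ A} {W V : Finset ι}
    (e : α.extend W ≤ β.extend W) (h : W ⊆ V) : α.extend V ≤ β.extend V := by
  have k := (hP.le_meet (γ := α.extend V)).1 le_rfl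
  exact hP.le_meet.2 ⟨(hP.le_meet.1 ((hP.le_meet.2
    ⟨k.1, k.2.trans ((re P _).monotone (hP.bigMeet_anti h ψ))⟩).trans e)).1, k.2⟩

instance (A : C) : Preorder (AxRep hP ψ A) where
  le α β := ∃ W : Finset ι, α.ax ⊆ W ∧ β.ax ⊆ W ∧ α.extend W ≤ β.extend W
  le_refl α := ⟨α.ax, subset_rfl, subset_rfl, le_rfl⟩
  le_trans := fun _ _ _ ⟨W, h, _, e⟩ ⟨V, _, k, e'⟩ => by
    classical
    exact ⟨W ∪ V, h.trans Finset.subset_union_left, k.trans Finset.subset_union_right,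
      (extend_mono e Finset.subset_union_left).trans (extend_mono e' Finset.subset_union_right)⟩

/-- The reindexing of `P^𝒰` along `f`. -/
def reindex {A B : C} (f : A ⟶ B) (β : AxRep hP ψ B) : AxRep hP ψ A where
  ax := β.ax
  form := re P f β.form
  le := by
    have h := (re P f).monotone β.le
    rwa [← re_comp, toUnit_unique (f ≫ toUnit B) (toUnit A)] at h

theorem reindex_extend {A B : C} (f : A ⟶ B) (β : AxRep hP ψ B) (W : Finset ι) :
    (reindex f β).extend W = re P f (β.extend W) := by
  have h := hP.re_meet_eq f β.form (re P (toUnit B) (hP.bigMeet W ψ))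
  rw [← re_comp, toUnit_unique (f ≫ toUnit B) (toUnit A)] at h
  exact h.symm

theorem reindex_mono {A B : C} (f : A ⟶ B) : Monotone (reindex (hP := hP) (ψ := ψ) f) := by
  rintro α β ⟨W, h, k, e⟩
  refine ⟨W, h, k, ?_⟩
  rw [reindex_extend, reindex_extend]
  exact (re P f).monotone e

theorem reindex_id {A : C} (α : AxRep hP ψ A) : reindex (𝟙 A) α = α := by
  cases α
  simp [reindex, re_id]

theorem reindex_comp {A B D : C} (f : A ⟶ B) (g : B ⟶ D) (α : AxRep hP ψ D) :
    reindex (f ≫ g) α = reindex f (reindex g α) := by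
  simp [reindex, re_comp]

/-- An element of `P(A)`, seen in the fiber of `P = P^∅`. -/
def ofEmpty (ψ : ι → Fib P (𝟙_ C)) {A : C} (α : Fib P A) : AxRep hP ψ A where
  ax := ∅
  form := α
  le := hP.re_top _ (fun _ => hP.le_bigMeet.2 (by simp)) _

theorem ofEmpty_mono {A : C} : Monotone (ofEmpty (hP := hP) ψ (A := A)) := fun _ _ h =>
  ⟨∅, subset_rfl, subset_rfl, hP.le_meet.2
    ⟨(hP.le_meet.1 le_rfl).1.trans h, (hP.le_meet.1 le_rfl).2⟩⟩

end AxRep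

/-- The directed colimit of the doctrines `P^𝒰` over the finite sets `𝒰` of axioms. Its fiber over
`A` consists of the classes `[α, 𝒰]`, with `α ∈ P^𝒰(A)`, ordered by `[α, 𝒰] ≤ [β, 𝒱]` iff
`α ∧ P(!)⋀_𝒲 ψ ≤ β ∧ P(!)⋀_𝒲 ψ` for some finite `𝒲 ⊇ 𝒰, 𝒱`. -/
noncomputable def addAxioms (hP : IsPrimary P) {ι : Type x} (ψ : ι → Fib P (𝟙_ C)) :
    Cᵒᵖ ⥤ PartOrd.{max w x} where
  obj Y := .of (Antisymmetrization (AxRep hP ψ Y.unop) (· ≤ ·))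
  map f := PartOrd.ofHom (OrderHom.antisymmetrization ⟨AxRep.reindex f.unop, AxRep.reindex_mono _⟩)
  map_id _ := by
    ext α
    induction α using Antisymmetrization.ind with
    | _ α => exact congrArg (toAntisymmetrization (· ≤ ·)) (AxRep.reindex_id α)
  map_comp f g := by
    ext α
    induction α using Antisymmetrization.ind with
    | _ α => exact congrArg (toAntisymmetrization (· ≤ ·)) (AxRep.reindex_comp g.unop f.unop α)

/-- The morphism from `P` to the colimit of the `P^𝒰`: the identity on the base category and
`α ↦ [α, ∅]` on the fibers. -/
noncomputable def toAxioms (hP : IsPrimary P) {ι : Type x} (ψ : ι → Fib P (𝟙_ C)) :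
    DoctrineHom P (addAxioms hP ψ) where
  functor := 𝟭 C
  preservesFiniteProducts := inferInstance
  app _ :=
    { toFun := fun α => toAntisymmetrization (· ≤ ·) (AxRep.ofEmpty (hP := hP) ψ α)
      monotone' := fun _ _ h => AxRep.ofEmpty_mono h }
  naturality _ _ := rfl

end AddAxioms

section Rich

variable {C : Type u} [Category.{v} C] [CartesianMonoidalCategory C]

/-- The ordinals below the cardinal `Λ = card (⨆_X P(X))`, which label the new constants. -/
abbrev Label (P : Cᵒᵖ ⥤ PartOrd.{w}) : Type (max u w) :=
  (Cardinal.mk (Σ X : C, Fib P X)).ord.ToType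

/-- The choices made in the construction of the rich doctrine: for each object `B`, a listing
`[φ^B_j, X̄^{(B,j)}]`, `j ∈ Λ`, of all the elements of `P̲(B)`, with chosen representatives, such
that the ordinals `d^B_j` defined recursively from it belong to `Λ`. -/
structure Listing (P : Cᵒᵖ ⥤ PartOrd.{w}) where
  /-- The context `X̄^{(B,j)}`. -/
  ctx : C → Label P → Ctx C (Label P)
  /-- The formula `φ^B_j`. -/
  form : ∀ (B : C) (j : Label P), Fib P ((ctx B j).prod ⊗ B)
  surjective : ∀ (B : C) (α : Fib (addConst P (Label P)) ⟨B⟩),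
    ∃ j, α = addConst.cls ⟨ctx B j, form B j⟩
  /-- The label `d^B_j`. -/
  wit : C → Label P → Label P
  wit_isLeast : ∀ (B : C) (j : Label P), IsLeast {o : Label P | (∀ h < j, wit B h < o) ∧
    ∀ k ≤ j, ∀ y ∈ (ctx B k).1, y.2 < o} (wit B j)

namespace Listing

variable {P : Cᵒᵖ ⥤ PartOrd.{w}} (L : Listing P) (hI : IsImplicational P) (hE : IsExistential P)

theorem wit_notMem (B : C) (j : Label P) : (B, L.wit B j) ∉ (L.ctx B j).1 := fun h =>
  lt_irrefl _ ((L.wit_isLeast B j).1.2 j le_rfl _ h)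

/-- The context `X̄^{(B,j)}_⋆`, obtained by adding `(B, d^B_j)` to `X̄^{(B,j)}`. -/
def ctxStar (B : C) (j : Label P) : Ctx C (Label P) :=
  (L.ctx B j).snoc (B, L.wit B j) (L.wit_notMem B j)

/-- The formula `ψ^B_j = P(pr₁)∃^B φ^B_j → φ^B_j` in `P(ΠX̄^{(B,j)} × B)`. -/
noncomputable def axForm (B : C) (j : Label P) : Fib P ((L.ctx B j).prod ⊗ B) :=
  hI.imp (re P (fst _ _) (hE.ex (L.form B j))) (L.form B j)

/-- The axiom `[ψ^B_j, X̄^{(B,j)}_⋆]` in `P̲(t)`. -/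
noncomputable def henkinAx (y : C × Label P) :
    Fib (addConst P (Label P)) (𝟙_ (ConstBase C (Label P))) :=
  addConst.cls (A := ⟨𝟙_ C⟩) ⟨L.ctxStar y.1 y.2, re P (fst _ _ ≫ lift
    (Ctx.restr ((L.ctx y.1 y.2).le_snoc _ (L.wit_notMem y.1 y.2)))
    ((L.ctxStar y.1 y.2).proj (y.1, L.wit y.1 y.2) (by simp [ctxStar, Ctx.snoc])))
    (L.axForm hI hE y.1 y.2)⟩

/-- The doctrine `P⃗`, with base category `C̲`, obtained from `P̲` by adding all the axioms. -/
noncomputable def rich : (ConstBase C (Label P))ᵒᵖ ⥤ PartOrd.{max u w} :=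
  addAxioms (hI.toIsPrimary.addConst (Label P)) (L.henkinAx hI hE)

/-- The morphism `(F, 𝔣) : P → P⃗`, with `F f = [f, ∅]` and `𝔣 α = [[α, ∅], ∅]`. -/
noncomputable def toRich : DoctrineHom P (L.rich hI hE) :=
  (toConst P (Label P)).comp (toAxioms _ _)

end Listing

end Rich

end RichDoctrine

/-! The engine is computation over a common finite list of constants. Lists are directed, so
finitely many arrows and elements of `C̲` and `P̲` have representatives over a single `Z`, where
they are ordinary data of `P` with the extra parameter `ΠZ`. The order on classes is inequality over
some larger list. The operations of `P` are stable under reindexing (for quantifiers this is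
Beck–Chevalley), so the meet, implication or quantifier of classes is the class of the one computed
over `Z` (`fcls_isGLB`, `fcls_isImp`, `fcls_isEx`, `fcls_isAll`). Adding axioms keeps the elements
and replaces `≤` by entailment modulo finitely many closed axioms (`acl_le_iff`); currying takes
care of implication, and Frobenius reciprocity of `∃`.

Richness is Henkin's argument. Every element of `P̲(B)` is some listed `φ^B_j`, and the axiom for
`(B, j)` says that if `φ^B_j` holds of anything, it holds of the new constant `d^B_j`
(`rcls_ex_le`).

For weak universality, a morphism out of `P̲` is built from `H` and points of `R`'s base
interpreting the constants. The label `d^B_j` exceeds all labels in `φ^B_j`, so witnesses in the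
rich doctrine `R` can be chosen by well-founded recursion on labels
(`Listing.exists_interpretation`). With this choice every axiom becomes true (`henkinAx_isTop`), and
the morphism descends to `P⃗`. Any `G` out of `P⃗` inherits structure from its restriction to `P`:
every element of `P⃗` is the reindexing of one from `P` along a tuple of constants (`rcls_eq_re`),
and reindexing in `R` respects the structure.

Listings exist for different reasons in the two cases. If `Λ` is infinite, each element is given `Λ`
many positions and is listed only after all its labels. If `Λ` is finite there is no room for delay,
but a pigeonhole argument on `T × Z × Zⁿ` shows that elements do not depend on the points at which
they are evaluated (`re_lift_eq_of_finite`), so one fixed list with a single label suffices. -/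

namespace RichDoctrine

/-! ### Uniqueness of meets, implications, quantifiers and fibered equalities. -/

section Uniqueness

variable {C : Type u} [Category.{v} C] {P : Cᵒᵖ ⥤ PartOrd.{w}}

theorem IsPrimary.meet_le_left (hP : IsPrimary P) {A : C} (α β : Fib P A) : hP.meet α β ≤ α :=
  (hP.le_meet.1 le_rfl).1

theorem IsPrimary.meet_le_right (hP : IsPrimary P) {A : C} (α β : Fib P A) : hP.meet α β ≤ β :=
  (hP.le_meet.1 le_rfl).2

theorem re_le_re_iff_of_iso {X Y : C} (e : X ≅ Y) {φ ψ : Fib P Y} :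
    re P e.hom φ ≤ re P e.hom ψ ↔ φ ≤ ψ := by
  refine ⟨fun h => ?_, fun h => (re P _).monotone h⟩
  have h := (re P e.inv).monotone h
  rwa [← re_comp, ← re_comp, e.inv_hom_id, re_id, re_id] at h

theorem IsPrimary.meet_right_comm (hP : IsPrimary P) {A : C} (α β γ : Fib P A) :
    hP.meet (hP.meet α β) γ = hP.meet (hP.meet α γ) β :=
  eq_of_forall_le_iff fun _ => by simp only [hP.le_meet]; tauto

theorem isImp_iff (hP : IsPrimary P) {A : C} {α β i : Fib P A} :
    IsImp α β i ↔ ∀ γ, γ ≤ i ↔ hP.meet γ α ≤ β := by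
  refine ⟨fun h γ => h γ _ (hP.meet_isGLB γ α), fun h γ m hm => ?_⟩
  rw [hm.unique (hP.meet_isGLB γ α)]
  exact h γ

theorem IsImp.unique (hP : IsPrimary P) {A : C} {α β i j : Fib P A} (h : IsImp α β i)
    (k : IsImp α β j) : i = j :=
  eq_of_forall_le_iff fun γ => ((isImp_iff hP).1 h γ).trans ((isImp_iff hP).1 k γ).symm

theorem IsImp.isTop (hP : IsPrimary P) {A : C} {α β i : Fib P A} (hi : IsImp α β i)
    (h : α ≤ β) : IsTop i :=
  fun γ => ((isImp_iff hP).1 hi γ).2 ((hP.meet_le_right γ α).trans h)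

theorem IsImplicational.imp_isImp (hP : IsImplicational P) {A : C} (α β : Fib P A) :
    IsImp α β (hP.imp α β) := (hP.exists_imp α β).choose_spec

variable [CartesianMonoidalCategory C]

theorem IsExistential.ex_isEx (hP : IsExistential P) {D B : C} (α : Fib P (D ⊗ B)) :
    IsEx P α (hP.ex α) := (hP.exists_ex α).choose_spec

theorem IsEx.unique {A B : C} {α : Fib P (A ⊗ B)} {e e' : Fib P A} (h : IsEx P α e)
    (k : IsEx P α e') : e = e' :=
  eq_of_forall_ge_iff fun γ => (h γ).trans (k γ).symm

theorem IsAll.unique {A B : C} {α : Fib P (A ⊗ B)} {e e' : Fib P A} (h : IsAll P α e)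
    (k : IsAll P α e') : e = e' :=
  eq_of_forall_le_iff fun γ => (h γ).trans (k γ).symm

/-- Substitutivity of a fibered equality with parameters. -/
theorem IsFiberedEq.subst_left {δ : ∀ A : C, Fib P (A ⊗ A)} (h : IsFiberedEq P δ)
    (hP : IsPrimary P) {X A : C} (φ : Fib P (X ⊗ A)) :
    hP.meet (re P (X ◁ fst A A) φ) (re P (snd X (A ⊗ A)) (δ A)) ≤ re P (X ◁ snd A A) φ := by
  -- On elements, `k` sends `(x, (a, a'))` to `((x, a), (x, a'))`; equality of these pairs follows
  -- from reflexivity in `X` and equality in `A`.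
  let k : X ⊗ (A ⊗ A) ⟶ (X ⊗ A) ⊗ (X ⊗ A) := lift (X ◁ fst A A) (X ◁ snd A A)
  have h₁ := (re P k).monotone (h.subst φ (hP.meet_isGLB _ (δ (X ⊗ A))))
  rw [hP.re_meet_eq, ← re_comp, ← re_comp, lift_fst, lift_snd] at h₁
  refine le_trans (hP.le_meet.2 ⟨hP.meet_le_left _ _, ?_⟩) h₁
  have h₂ := (re P k).monotone (h.prod (hP.meet_isGLB (re P (fst X A ⊗ₘ fst X A) (δ X))
    (re P (snd X A ⊗ₘ snd X A) (δ A))))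
  rw [hP.re_meet_eq, ← re_comp, ← re_comp] at h₂
  refine le_trans (hP.le_meet.2 ⟨?_, ?_⟩) h₂
  · have e : k ≫ (fst X A ⊗ₘ fst X A) = fst X (A ⊗ A) ≫ lift (𝟙 X) (𝟙 X) := by
      ext <;> simp [k]
    rw [e, re_comp]
    exact hP.re_top _ (h.refl X) _
  · have e : k ≫ (snd X A ⊗ₘ snd X A) = snd X (A ⊗ A) := by
      ext <;> simp [k]
    rw [e]
    exact hP.meet_le_right _ _

/-- Substituting the second variable in `ε(a, -)` gives `ε(a, a) ∧ δ(a, b) ≤ ε(a, b)`, and `ε(a, a)`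
is true. Formally, `subst_left` is evaluated at `(a, (a, b))`. -/
theorem IsFiberedEq.le {δ ε : ∀ A : C, Fib P (A ⊗ A)} (h : IsFiberedEq P δ)
    (k : IsFiberedEq P ε) (hP : IsPrimary P) (A : C) : δ A ≤ ε A := by
  have h₁ := (re P (lift (fst A A) (𝟙 (A ⊗ A)))).monotone (h.subst_left hP (ε A))
  rw [hP.re_meet_eq, ← re_comp, ← re_comp, ← re_comp, lift_snd, re_id] at h₁
  have e₁ : lift (fst A A) (𝟙 (A ⊗ A)) ≫ A ◁ fst A A = fst A A ≫ lift (𝟙 A) (𝟙 A) := by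
    ext <;> simp
  have e₂ : lift (fst A A) (𝟙 (A ⊗ A)) ≫ A ◁ snd A A = 𝟙 (A ⊗ A) := by
    ext <;> simp
  rw [e₁, e₂, re_id, re_comp] at h₁
  exact (hP.le_meet.2 ⟨hP.re_top _ (k.refl A) _, le_rfl⟩).trans h₁

theorem IsFiberedEq.unique {δ ε : ∀ A : C, Fib P (A ⊗ A)} (h : IsFiberedEq P δ)
    (k : IsFiberedEq P ε) (hP : IsPrimary P) : δ = ε :=
  funext fun A => (h.le k hP A).antisymm (k.le h hP A)

end Uniqueness

/-! ### Arrows and elements represented over a common context. -/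

section CommonContext

variable {C : Type u} [Category.{v} C] [CartesianMonoidalCategory C] {Λ : Type x}

namespace ConstBase

variable {A B D : C}

/-- The class `[f, Z̄]` of an arrow `f : ΠZ̄ × A ⟶ B`. -/
noncomputable def acls (Z : Ctx C Λ) (f : Z.prod ⊗ A ⟶ B) : (⟨A⟩ : ConstBase C Λ) ⟶ ⟨B⟩ :=
  cls ⟨Z, f⟩

/-- The class `[f, ∅]` of an arrow of `C`. -/
noncomputable def iota (Λ : Type x) (f : A ⟶ B) : (⟨A⟩ : ConstBase C Λ) ⟶ ⟨B⟩ :=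
  (incl C Λ).map f

theorem cls_eq_acls (f : ArrRep Λ A B) {Z : Ctx C Λ} (h : f.ctx ≤ Z) :
    (cls f : (⟨A⟩ : ConstBase C Λ) ⟶ ⟨B⟩) = acls Z (f.extend h) :=
  cls_eq h le_rfl (by simp [ArrRep.extend])

theorem acls_mono {Z W : Ctx C Λ} (h : Z ≤ W) (f : Z.prod ⊗ A ⟶ B) :
    acls Z f = acls W (Ctx.restr h ▷ A ≫ f) :=
  cls_eq_acls ⟨Z, f⟩ h

theorem iota_eq_acls (f : A ⟶ B) (Z : Ctx C Λ) : iota Λ f = acls Z (snd _ _ ≫ f) := by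
  refine (cls_eq_acls _ (ArrRep.const_le f Z)).trans ?_
  rw [ArrRep.const_extend]

theorem exists_acls (f : (⟨A⟩ : ConstBase C Λ) ⟶ ⟨B⟩) :
    ∃ (Z : Ctx C Λ) (g : Z.prod ⊗ A ⟶ B), f = acls Z g := by
  obtain ⟨f, rfl⟩ := exists_cls f
  exact ⟨f.ctx, f.arr, rfl⟩

theorem acls_comp (Z : Ctx C Λ) (f : Z.prod ⊗ A ⟶ B) (g : Z.prod ⊗ B ⟶ D) :
    acls Z f ≫ acls Z g = acls Z (lift (fst _ _) f ≫ g) := by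
  refine (cls_eq_acls ((⟨Z, f⟩ : ArrRep Λ A B).comp ⟨Z, g⟩)
    (ArrRep.comp_le (le_refl Z) (le_refl Z))).trans ?_
  rw [ArrRep.comp_extend]
  simp [ArrRep.extend]

theorem iota_comp (f : A ⟶ B) (g : B ⟶ D) : iota Λ (f ≫ g) = iota Λ f ≫ iota Λ g :=
  (incl C Λ).map_comp f g

theorem acls_comp_iota (Z : Ctx C Λ) (f : Z.prod ⊗ A ⟶ B) (g : B ⟶ D) :
    acls Z f ≫ iota Λ g = acls Z (f ≫ g) := by
  rw [iota_eq_acls g Z, acls_comp, lift_snd_assoc]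

theorem iota_comp_acls (Z : Ctx C Λ) (f : A ⟶ B) (g : Z.prod ⊗ B ⟶ D) :
    iota Λ f ≫ acls Z g = acls Z (Z.prod ◁ f ≫ g) := by
  rw [iota_eq_acls f Z, acls_comp]
  congr 2
  ext <;> simp

theorem hom_tensor_ext {f g : (⟨A⟩ : ConstBase C Λ) ⟶ ⟨B ⊗ D⟩}
    (h₁ : f ≫ iota Λ (fst B D) = g ≫ iota Λ (fst B D))
    (h₂ : f ≫ iota Λ (snd B D) = g ≫ iota Λ (snd B D)) : f = g :=
  prod_ext (B := ⟨B⟩) (D := ⟨D⟩) h₁ h₂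

theorem acls_whiskerRight (Z : Ctx C Λ) (f : Z.prod ⊗ A ⟶ B) (D : C) :
    acls Z f ▷ (⟨D⟩ : ConstBase C Λ) =
      acls Z (lift (Z.prod ◁ fst A D ≫ f) (snd Z.prod (A ⊗ D) ≫ snd A D)) := by
  refine hom_tensor_ext (A := A ⊗ D) ?_ ?_
  · refine (whiskerRight_fst (acls Z f) (⟨D⟩ : ConstBase C Λ)).trans ?_
    rw [acls_comp_iota, lift_fst]
    exact iota_comp_acls Z (fst A D) f
  · refine (whiskerRight_snd (acls Z f) (⟨D⟩ : ConstBase C Λ)).trans ?_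
    rw [acls_comp_iota, lift_snd]
    exact iota_eq_acls (snd A D) Z

theorem iota_lift (f : A ⟶ B) (g : A ⟶ D) :
    (lift (iota Λ f) (iota Λ g) : _ ⟶ (⟨B⟩ ⊗ ⟨D⟩ : ConstBase C Λ)) = iota Λ (lift f g) := by
  refine hom_tensor_ext ((lift_fst _ _).trans ?_) ((lift_snd _ _).trans ?_)
  · rw [← iota_comp, lift_fst]
  · rw [← iota_comp, lift_snd]

theorem iota_tensorHom {A' B' : C} (f : A ⟶ A') (g : B ⟶ B') :
    (iota Λ f ⊗ₘ iota Λ g) = iota Λ (f ⊗ₘ g) := by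
  refine hom_tensor_ext (A := A ⊗ B) ((tensorHom_fst _ _).trans ?_) ((tensorHom_snd _ _).trans ?_)
  · rw [← iota_comp, tensorHom_fst, iota_comp]
    rfl
  · rw [← iota_comp, tensorHom_snd, iota_comp]
    rfl

/-- The products of `C̲` are literally those of `C`. Consequently `appProd` for the morphism out of
`P` is plain application, with no transport. -/
theorem prodComparison_incl (A B : C) :
    CartesianMonoidalCategory.prodComparison (incl C Λ) A B = 𝟙 _ :=
  (iota_lift (fst A B) (snd A B)).trans (by rw [lift_fst_snd]; rfl)

end ConstBase

namespace addConst

variable {P : Cᵒᵖ ⥤ PartOrd.{w}} {A B : C}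

/-- The class `[φ, Z̄]` of `φ ∈ P(ΠZ̄ × A)`. -/
noncomputable def fcls (Z : Ctx C Λ) (φ : Fib P (Z.prod ⊗ A)) : Fib (addConst P Λ) ⟨A⟩ :=
  cls ⟨Z, φ⟩

/-- The class `[α, ∅]` of `α ∈ P(A)`. -/
noncomputable def ccls (Λ : Type x) (α : Fib P A) : Fib (addConst P Λ) ⟨A⟩ :=
  cls (FormRep.const Λ α)

theorem cls_eq_fcls (φ : FormRep P Λ A) {Z : Ctx C Λ} (h : φ.ctx ≤ Z) :
    (cls φ : Fib (addConst P Λ) ⟨A⟩) = fcls Z (φ.extend h) :=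
  cls_eq h le_rfl (by simp [FormRep.extend, re_id])

theorem fcls_mono {Z W : Ctx C Λ} (h : Z ≤ W) (φ : Fib P (Z.prod ⊗ A)) :
    fcls Z φ = fcls W (re P (Ctx.restr h ▷ A) φ) :=
  cls_eq_fcls ⟨Z, φ⟩ h

theorem ccls_eq_fcls (Z : Ctx C Λ) (α : Fib P A) :
    ccls Λ α = fcls Z (re P (snd _ _) α) := by
  refine (cls_eq_fcls _ (FormRep.const_le α Z)).trans ?_
  rw [FormRep.const_extend]

theorem exists_fcls (α : Fib (addConst P Λ) ⟨A⟩) :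
    ∃ (Z : Ctx C Λ) (φ : Fib P (Z.prod ⊗ A)), α = fcls Z φ := by
  obtain ⟨φ, rfl⟩ := exists_cls α
  exact ⟨φ.ctx, φ.form, rfl⟩

theorem exists_fcls_of_le (α : Fib (addConst P Λ) ⟨A⟩) (W : Ctx C Λ) :
    ∃ (Z : Ctx C Λ) (_ : W ≤ Z) (φ : Fib P (Z.prod ⊗ A)), α = fcls Z φ := by
  obtain ⟨Z, φ, rfl⟩ := exists_fcls α
  exact ⟨W.join Z, W.le_left Z, _, fcls_mono (W.le_right Z) φ⟩

theorem exists_fcls₂ (α : Fib (addConst P Λ) ⟨A⟩)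
    (β : Fib (addConst P Λ) ⟨B⟩) : ∃ (Z : Ctx C Λ) (φ : Fib P (Z.prod ⊗ A))
      (ψ : Fib P (Z.prod ⊗ B)), α = fcls Z φ ∧ β = fcls Z ψ := by
  obtain ⟨W, φ, rfl⟩ := exists_fcls α
  obtain ⟨Z, h, ψ, rfl⟩ := exists_fcls_of_le β W
  exact ⟨Z, _, ψ, fcls_mono h φ, rfl⟩

theorem fcls_le_iff {Z : Ctx C Λ} {φ ψ : Fib P (Z.prod ⊗ A)} :
    fcls Z φ ≤ fcls Z ψ ↔ ∃ (W : Ctx C Λ) (h : Z ≤ W),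
      re P (Ctx.restr h ▷ A) φ ≤ re P (Ctx.restr h ▷ A) ψ :=
  ⟨fun ⟨W, h, _, e⟩ => ⟨W, h, e⟩, fun ⟨W, h, e⟩ => ⟨W, h, h, e⟩⟩

theorem fcls_le {Z : Ctx C Λ} {φ ψ : Fib P (Z.prod ⊗ A)} (h : φ ≤ ψ) : fcls Z φ ≤ fcls Z ψ :=
  fcls_le_iff.2 ⟨Z, le_rfl, (re P _).monotone h⟩

theorem re_acls (Z : Ctx C Λ) (f : Z.prod ⊗ A ⟶ B) (ψ : Fib P (Z.prod ⊗ B)) :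
    re (addConst P Λ) (ConstBase.acls Z f) (fcls Z ψ) = fcls Z (re P (lift (fst _ _) f) ψ) := by
  refine (cls_eq_fcls (FormRep.reindex (⟨Z, f⟩ : ArrRep Λ A B) ⟨Z, ψ⟩)
    (FormRep.reindex_le (le_refl Z) (le_refl Z))).trans ?_
  rw [FormRep.reindex_extend]
  simp [FormRep.extend, ArrRep.extend, re_id]

theorem re_iota (Z : Ctx C Λ) (f : A ⟶ B) (ψ : Fib P (Z.prod ⊗ B)) :
    re (addConst P Λ) (ConstBase.iota Λ f) (fcls Z ψ) = fcls Z (re P (Z.prod ◁ f) ψ) := by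
  have e : lift (fst Z.prod A) (snd Z.prod A ≫ f) = Z.prod ◁ f := by ext <;> simp
  rw [ConstBase.iota_eq_acls f Z, re_acls, e]

theorem re_fst (Z : Ctx C Λ) (ψ : Fib P (Z.prod ⊗ A)) :
    re (addConst P Λ) (fst (⟨A⟩ : ConstBase C Λ) ⟨B⟩) (fcls Z ψ) =
      fcls Z (re P (Z.prod ◁ fst A B) ψ) :=
  re_iota Z (fst A B) ψ

theorem re_acls_ccls (Z : Ctx C Λ) (f : Z.prod ⊗ A ⟶ B)
    (β : Fib P B) : re (addConst P Λ) (ConstBase.acls Z f) (ccls Λ β) = fcls Z (re P f β) := by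
  rw [ccls_eq_fcls Z, re_acls, ← re_comp, lift_snd]

theorem re_iota_ccls (f : A ⟶ B) (β : Fib P B) :
    re (addConst P Λ) (ConstBase.iota Λ f) (ccls Λ β) = ccls Λ (re P f β) :=
  ((toConst P Λ).naturality f β).symm

/-- Quantifiers in `P` act on `(ΠZ × A) × D`, while elements over `A × D` live on `ΠZ × (A × D)`.
Reindexing is therefore described up to the associator, in the shape that Beck–Chevalley in `P`
produces. -/
theorem re_acls_whiskerRight {D : C} (Z : Ctx C Λ) (f : Z.prod ⊗ A ⟶ B)
    (φ : Fib P (Z.prod ⊗ (B ⊗ D))) :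
    ∃ ψ, re (addConst P Λ) (ConstBase.acls Z f ▷ ⟨D⟩) (fcls Z φ) = fcls Z ψ ∧
      re P (α_ Z.prod A D).hom ψ =
        re P (lift (fst _ _) f ▷ D) (re P (α_ Z.prod B D).hom φ) := by
  rw [ConstBase.acls_whiskerRight]
  refine ⟨_, re_acls Z _ φ, ?_⟩
  rw [← re_comp, ← re_comp]
  congr 2
  apply CartesianMonoidalCategory.hom_ext
  · simp
  · apply CartesianMonoidalCategory.hom_ext
    · have e : (α_ Z.prod A D).hom ≫ Z.prod ◁ fst A D = fst (Z.prod ⊗ A) D := by ext <;> simp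
      simp only [comp_lift, lift_fst, lift_snd, Category.assoc, associator_hom_snd_fst]
      simp [← Category.assoc, e]
    · simp

variable (Z : Ctx C Λ)

theorem fcls_isTop (hP : IsPrimary P) {t : Fib P (Z.prod ⊗ A)} (ht : IsTop t) :
    IsTop (fcls Z t) := fun γ => by
  obtain ⟨W, h, γ, rfl⟩ := exists_fcls_of_le γ Z
  rw [fcls_mono h]
  exact fcls_le (hP.re_top _ ht _)

theorem fcls_isBot (hP : ∀ {A B : C} (f : A ⟶ B) {b : Fib P B}, IsBot b → IsBot (re P f b))
    {b : Fib P (Z.prod ⊗ A)} (hb : IsBot b) : IsBot (fcls Z b) := fun γ => by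
  obtain ⟨W, h, γ, rfl⟩ := exists_fcls_of_le γ Z
  rw [fcls_mono h]
  exact fcls_le (hP _ hb _)

/-- A lower bound is below `φ` over one list and below `ψ` over another; over the join of the two
lists it is below both, and reindexing preserves the meet. -/
theorem fcls_isGLB (hP : IsPrimary P) {φ ψ m : Fib P (Z.prod ⊗ A)} (hm : IsGLB {φ, ψ} m) :
    IsGLB {fcls Z φ, fcls Z ψ} (fcls Z m) := by
  obtain rfl := hm.unique (hP.meet_isGLB _ _)
  refine ⟨?_, fun γ hγ => ?_⟩
  · rintro _ (rfl | rfl)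
    exacts [fcls_le (hP.meet_le_left _ _), fcls_le (hP.meet_le_right _ _)]
  · have h₁ := hγ (Set.mem_insert _ _)
    have h₂ := hγ (Set.mem_insert_of_mem _ rfl)
    obtain ⟨V, h, γ, rfl⟩ := exists_fcls_of_le γ Z
    rw [fcls_mono h] at h₁ h₂ ⊢
    obtain ⟨W₁, k₁, h₁⟩ := fcls_le_iff.1 h₁
    obtain ⟨W₂, k₂, h₂⟩ := fcls_le_iff.1 h₂
    have l₁ := (re P (Ctx.restr (W₁.le_left W₂) ▷ A)).monotone h₁
    have l₂ := (re P (Ctx.restr (W₁.le_right W₂) ▷ A)).monotone h₂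
    refine fcls_le_iff.2 ⟨W₁.join W₂, k₁.trans (W₁.le_left W₂), ?_⟩
    simp only [← re_comp, ← comp_whiskerRight, Ctx.restr_restr] at l₁ l₂ ⊢
    rw [hP.re_meet_eq]
    exact hP.le_meet.2 ⟨l₁, l₂⟩

theorem fcls_meet (hP : IsPrimary P) (φ ψ : Fib P (Z.prod ⊗ A)) :
    (hP.addConst Λ).meet (fcls Z φ) (fcls Z ψ) = fcls Z (hP.meet φ ψ) :=
  ((hP.addConst Λ).meet_isGLB _ _).unique (fcls_isGLB Z hP (hP.meet_isGLB φ ψ))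

/-- Both sides of the adjunction are inequalities over some list `W`, and they are equivalent for
each `W` separately because implications are stable under reindexing. -/
theorem fcls_isImp (hP : IsImplicational P) {φ ψ i : Fib P (Z.prod ⊗ A)} (hi : IsImp φ ψ i) :
    IsImp (fcls Z φ) (fcls Z ψ) (fcls Z i) := by
  refine (isImp_iff (hP.toIsPrimary.addConst Λ)).2 fun γ => ?_
  obtain ⟨V, h, γ, rfl⟩ := exists_fcls_of_le γ Z
  rw [fcls_mono h i, fcls_mono h φ, fcls_mono h ψ, fcls_meet V hP.toIsPrimary, fcls_le_iff,
    fcls_le_iff]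
  refine exists₂_congr fun W k => ?_
  simp only [hP.toIsPrimary.re_meet_eq]
  exact (isImp_iff hP.toIsPrimary).1 (hP.re_imp _ (hP.re_imp _ hi)) _

theorem whiskerRight_assoc_hom {X Y : C} (r : X ⟶ Y) :
    (r ▷ A) ▷ B ≫ (α_ Y A B).hom = (α_ X A B).hom ≫ r ▷ (A ⊗ B) := by simp

theorem fst_whiskerRight_assoc {X Y : C} (r : X ⟶ Y) :
    fst (X ⊗ A) B ≫ r ▷ A = (α_ X A B).hom ≫ r ▷ (A ⊗ B) ≫ Y ◁ fst A B := by
  ext <;> simp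

/-- Definitional, since the product of `⟨A⟩` and `⟨B⟩` in `C̲` is `⟨A ⊗ B⟩` with first projection
the class of `fst A B`. The restatement makes the `fcls` calculus applicable. -/
theorem isEx_iff {α : Fib (addConst P Λ) ⟨A ⊗ B⟩} {e : Fib (addConst P Λ) ⟨A⟩} :
    IsEx (addConst P Λ) (D := ⟨A⟩) (B := ⟨B⟩) α e ↔
      ∀ β, e ≤ β ↔ α ≤ re (addConst P Λ) (ConstBase.iota Λ (fst A B)) β := Iff.rfl

theorem isAll_iff {α : Fib (addConst P Λ) ⟨A ⊗ B⟩} {e : Fib (addConst P Λ) ⟨A⟩} :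
    IsAll (addConst P Λ) (D := ⟨A⟩) (B := ⟨B⟩) α e ↔
      ∀ β, β ≤ e ↔ re (addConst P Λ) (ConstBase.iota Λ (fst A B)) β ≤ α := Iff.rfl

/-- The adjunction is verified list by list: Beck–Chevalley along `ΠW × A ⟶ ΠZ × A` says that `e`,
reindexed to `W`, is still the existential quantification of the reindexed `φ`. -/
theorem fcls_isEx (hP : IsExistential P) {φ : Fib P (Z.prod ⊗ (A ⊗ B))}
    {e : Fib P (Z.prod ⊗ A)} (he : IsEx P (re P (α_ Z.prod A B).hom φ) e) :
    IsEx (addConst P Λ) (D := ⟨A⟩) (B := ⟨B⟩) (fcls (A := A ⊗ B) Z φ) (fcls Z e) := by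
  refine isEx_iff.2 fun β => ?_
  obtain ⟨V, h, β, rfl⟩ := exists_fcls_of_le β Z
  have he' := hP.beck_chevalley (Ctx.restr h ▷ A) he
  rw [← re_comp, whiskerRight_assoc_hom, re_comp] at he'
  rw [re_iota, fcls_mono h e, fcls_mono h φ, fcls_le_iff]
  refine Iff.trans ?_ fcls_le_iff.symm
  refine exists₂_congr fun W k => ?_
  have he'' := hP.beck_chevalley (Ctx.restr k ▷ A) he'
  rw [← re_comp, whiskerRight_assoc_hom, re_comp] at he''
  rw [he'' _, ← re_comp P (fst _ _), fst_whiskerRight_assoc, re_comp P (α_ _ _ _).hom,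
    re_le_re_iff_of_iso, re_comp]

theorem fcls_isAll (hP : IsUniversal P) {φ : Fib P (Z.prod ⊗ (A ⊗ B))}
    {e : Fib P (Z.prod ⊗ A)} (he : IsAll P (re P (α_ Z.prod A B).hom φ) e) :
    IsAll (addConst P Λ) (D := ⟨A⟩) (B := ⟨B⟩) (fcls (A := A ⊗ B) Z φ) (fcls Z e) := by
  refine isAll_iff.2 fun β => ?_
  obtain ⟨V, h, β, rfl⟩ := exists_fcls_of_le β Z
  have he' := hP.beck_chevalley (Ctx.restr h ▷ A) he
  rw [← re_comp, whiskerRight_assoc_hom, re_comp] at he'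
  rw [re_iota, fcls_mono h e, fcls_mono h φ, fcls_le_iff]
  refine Iff.trans ?_ fcls_le_iff.symm
  refine exists₂_congr fun W k => ?_
  have he'' := hP.beck_chevalley (Ctx.restr k ▷ A) he'
  rw [← re_comp, whiskerRight_assoc_hom, re_comp] at he''
  rw [he'' _, ← re_comp P (fst _ _), fst_whiskerRight_assoc, re_comp P (α_ _ _ _).hom,
    re_le_re_iff_of_iso, re_comp]

end addConst

end CommonContext

/-! ### `P̲` inherits each structure of `P`. -/

section AddConstStructure

variable {C : Type u} [Category.{v} C] [CartesianMonoidalCategory C] {P : Cᵒᵖ ⥤ PartOrd.{w}}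
  (Λ : Type x)

open addConst ConstBase

theorem IsImplicational.addConst (hP : IsImplicational P) : IsImplicational (addConst P Λ) where
  toIsPrimary := hP.toIsPrimary.addConst Λ
  exists_imp {A} α β := by
    obtain ⟨A⟩ := A
    obtain ⟨Z, φ, ψ, rfl, rfl⟩ := exists_fcls₂ α β
    exact ⟨_, fcls_isImp Z hP (hP.imp_isImp φ ψ)⟩
  re_imp {A B} f α β i hi := by
    obtain ⟨A⟩ := A
    obtain ⟨B⟩ := B
    obtain ⟨W, f, rfl⟩ := exists_acls f
    obtain ⟨V, φ, ψ, rfl, rfl⟩ := exists_fcls₂ α β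
    rw [fcls_mono (W.le_right V) φ, fcls_mono (W.le_right V) ψ] at hi ⊢
    rw [acls_mono (W.le_left V) f]
    have h := hP.imp_isImp (re P (Ctx.restr (W.le_right V) ▷ B) φ)
      (re P (Ctx.restr (W.le_right V) ▷ B) ψ)
    obtain rfl := hi.unique (hP.toIsPrimary.addConst Λ) (fcls_isImp _ hP h)
    rw [re_acls, re_acls, re_acls]
    exact fcls_isImp _ hP (hP.re_imp _ h)

theorem IsExistential.addConst (hP : IsExistential P) : IsExistential (addConst P Λ) where
  toIsPrimary := hP.toIsPrimary.addConst Λ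
  exists_ex {A B} α := by
    obtain ⟨A⟩ := A
    obtain ⟨B⟩ := B
    obtain ⟨Z, φ, rfl⟩ := exists_fcls (A := A ⊗ B) α
    exact ⟨_, fcls_isEx Z hP (hP.ex_isEx (re P (α_ Z.prod A B).hom φ))⟩
  beck_chevalley {A A' B} f α e he := by
    obtain ⟨A⟩ := A
    obtain ⟨B⟩ := B
    obtain ⟨A'⟩ := A'
    obtain ⟨W, f, rfl⟩ := exists_acls f
    obtain ⟨Z, h, φ, rfl⟩ := exists_fcls_of_le (A := A' ⊗ B) α W
    rw [acls_mono h f]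
    -- Quantifications are unique, so the given `e` may be replaced by the class of the one computed
    -- over `Z`. The same replacement is used for the other operations.
    have k := hP.ex_isEx (re P (α_ Z.prod A' B).hom φ)
    obtain rfl := he.unique (fcls_isEx Z hP k)
    obtain ⟨ψ, e₁, e₂⟩ := re_acls_whiskerRight (D := B) Z (Ctx.restr h ▷ A ≫ f) φ
    rw [e₁, re_acls]
    refine fcls_isEx Z hP ?_
    rw [e₂]
    exact hP.beck_chevalley _ k
  frobenius {A B} α m β e n he hm hn := by
    obtain ⟨A⟩ := A
    obtain ⟨B⟩ := B
    obtain ⟨Z, φ, ψ, rfl, rfl⟩ := exists_fcls₂ (A := A ⊗ B) α β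
    have k := hP.ex_isEx (re P (α_ Z.prod A B).hom φ)
    obtain rfl := he.unique (fcls_isEx Z hP k)
    obtain rfl := hn.unique (fcls_isGLB Z hP.toIsPrimary (hP.toIsPrimary.meet_isGLB _ _))
    rw [re_fst] at hm
    obtain rfl := hm.unique (fcls_isGLB (A := A ⊗ B) Z hP.toIsPrimary
      (hP.toIsPrimary.meet_isGLB _ _))
    refine fcls_isEx Z hP (hP.frobenius k ?_ (hP.toIsPrimary.meet_isGLB _ _))
    have e : fst (Z.prod ⊗ A) B = (α_ Z.prod A B).hom ≫ Z.prod ◁ fst A B := by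
      ext <;> simp
    rw [e, re_comp]
    exact hP.re_meet _ (hP.toIsPrimary.meet_isGLB _ _)

theorem IsUniversal.addConst (hP : IsUniversal P) : IsUniversal (addConst P Λ) where
  exists_all {A B} α := by
    obtain ⟨A⟩ := A
    obtain ⟨B⟩ := B
    obtain ⟨Z, φ, rfl⟩ := exists_fcls (A := A ⊗ B) α
    obtain ⟨e, k⟩ := hP.exists_all (re P (α_ Z.prod A B).hom φ)
    exact ⟨_, fcls_isAll Z hP k⟩
  beck_chevalley {A A' B} f α e he := by
    obtain ⟨A⟩ := A
    obtain ⟨B⟩ := B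
    obtain ⟨A'⟩ := A'
    obtain ⟨W, f, rfl⟩ := exists_acls f
    obtain ⟨Z, h, φ, rfl⟩ := exists_fcls_of_le (A := A' ⊗ B) α W
    rw [acls_mono h f]
    obtain ⟨e, k⟩ := hP.exists_all (re P (α_ Z.prod A' B).hom φ)
    obtain rfl := he.unique (fcls_isAll Z hP k)
    obtain ⟨ψ, e₁, e₂⟩ := re_acls_whiskerRight (D := B) Z (Ctx.restr h ▷ A ≫ f) φ
    rw [e₁, re_acls]
    refine fcls_isAll Z hP ?_
    rw [e₂]
    exact hP.beck_chevalley _ k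

theorem IsBounded.addConst (hP : IsBounded P) : IsBounded (addConst P Λ) where
  exists_top A := by
    obtain ⟨A⟩ := A
    obtain ⟨t, ht⟩ := hP.exists_top ((Ctx.empty : Ctx C Λ).prod ⊗ A)
    refine ⟨fcls Ctx.empty t, fun γ => ?_⟩
    obtain ⟨W, h, γ, rfl⟩ := exists_fcls_of_le γ Ctx.empty
    rw [fcls_mono h]
    exact fcls_le (hP.re_top _ ht _)
  exists_bot A := by
    obtain ⟨A⟩ := A
    obtain ⟨t, ht⟩ := hP.exists_bot ((Ctx.empty : Ctx C Λ).prod ⊗ A)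
    exact ⟨_, fcls_isBot Ctx.empty hP.re_bot ht⟩
  re_top {A B} f t ht γ := by
    obtain ⟨A⟩ := A
    obtain ⟨B⟩ := B
    obtain ⟨W, f, rfl⟩ := exists_acls f
    obtain ⟨Z, h, γ, rfl⟩ := exists_fcls_of_le γ W
    -- The given top `t` carries no convenient representative; it suffices that it dominates the
    -- class of a top element `s` over `Z`.
    obtain ⟨s, hs⟩ := hP.exists_top (Z.prod ⊗ B)
    rw [acls_mono h f]
    refine le_trans ?_ ((re _ _).monotone (ht (fcls Z s)))
    rw [re_acls]
    exact fcls_le (hP.re_top _ hs _)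
  re_bot {A B} f b hb γ := by
    obtain ⟨A⟩ := A
    obtain ⟨B⟩ := B
    obtain ⟨W, f, rfl⟩ := exists_acls f
    obtain ⟨Z, h, γ, rfl⟩ := exists_fcls_of_le γ W
    obtain ⟨s, hs⟩ := hP.exists_bot (Z.prod ⊗ B)
    rw [acls_mono h f]
    refine ((re _ _).monotone (hb (fcls Z s))).trans ?_
    rw [re_acls]
    exact fcls_le (hP.re_bot _ hs _)

theorem IsFiberedEq.addConst {δ : ∀ A : C, Fib P (A ⊗ A)} (h : IsFiberedEq P δ)
    (hP : IsPrimary P) :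
    IsFiberedEq (addConst P Λ) fun A : ConstBase C Λ => (ccls Λ (δ A.of) :) where
  refl A := by
    obtain ⟨A⟩ := A
    have e : lift (𝟙 (⟨A⟩ : ConstBase C Λ)) (𝟙 _) = iota Λ (lift (𝟙 A) (𝟙 A)) := iota_lift _ _
    rw [e]
    have k := re_iota_ccls (Λ := Λ) (lift (𝟙 A) (𝟙 A)) (δ A)
    exact (congrArg IsTop k).mpr (top_isTop hP (h.refl A))
  subst {A} α m hm := by
    obtain ⟨A⟩ := A
    obtain ⟨Z, φ, rfl⟩ := exists_fcls α
    have k : m = fcls Z _ := hm.unique (by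
      rw [re_fst]
      exact (congrArg (fun a => IsGLB {_, a} _) (ccls_eq_fcls Z (δ A))).mpr
        (fcls_isGLB Z hP (hP.meet_isGLB _ _)))
    rw [k]
    exact (fcls_le (h.subst_left hP φ)).trans_eq (re_iota Z (snd A A) φ).symm
  prod {A B} m hm := by
    obtain ⟨A⟩ := A
    obtain ⟨B⟩ := B
    have k₁ : re (RichDoctrine.addConst P Λ) (fst ⟨A⟩ ⟨B⟩ ⊗ₘ fst ⟨A⟩ ⟨B⟩) (ccls Λ (δ A)) =
        ccls Λ (re P (fst A B ⊗ₘ fst A B) (δ A)) :=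
      (congrArg (fun f => re (RichDoctrine.addConst P Λ) f (ccls Λ (δ A)))
        (iota_tensorHom (fst A B) (fst A B))).trans (re_iota_ccls _ _)
    have k₂ : re (RichDoctrine.addConst P Λ) (snd ⟨A⟩ ⟨B⟩ ⊗ₘ snd ⟨A⟩ ⟨B⟩) (ccls Λ (δ B)) =
        ccls Λ (re P (snd A B ⊗ₘ snd A B) (δ B)) :=
      (congrArg (fun f => re (RichDoctrine.addConst P Λ) f (ccls Λ (δ B)))
        (iota_tensorHom (snd A B) (snd A B))).trans (re_iota_ccls _ _)
    have k : m = fcls Ctx.empty _ := hm.unique (by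
      refine (congrArg₂ (fun a b => IsGLB {a, b} _) k₁ k₂).mpr ?_
      rw [ccls_eq_fcls Ctx.empty, ccls_eq_fcls Ctx.empty]
      exact fcls_isGLB _ hP (hP.re_meet _ (hP.meet_isGLB _ _)))
    rw [k]
    exact fcls_le ((re P _).monotone (h.prod (hP.meet_isGLB _ _)))

end AddConstStructure


/-! ### Adding closed axioms preserves each structure. -/

section AddAxiomsStructure

variable {C : Type u} [Category.{v} C] [CartesianMonoidalCategory C] {P : Cᵒᵖ ⥤ PartOrd.{w}}

namespace addAxioms

variable (hP : IsPrimary P) {ι : Type x} (ψ : ι → Fib P (𝟙_ C)) {A B : C}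

/-- The class `[α, ∅]` of `α ∈ P(A)` after adding the axioms. -/
noncomputable def acl (α : Fib P A) : Fib (addAxioms hP ψ) A := (toAxioms hP ψ).app A α

/-- The conjunction of the axioms indexed by `W`, seen in `P(A)`. -/
noncomputable def conj (A : C) (W : Finset ι) : Fib P A := re P (toUnit A) (hP.bigMeet W ψ)

theorem re_conj (f : A ⟶ B) (W : Finset ι) : re P f (conj hP ψ B W) = conj hP ψ A W := by
  rw [conj, ← re_comp, toUnit_unique (f ≫ toUnit B) (toUnit A)]
  rfl

theorem conj_anti {W V : Finset ι} (h : W ⊆ V) : conj hP ψ A V ≤ conj hP ψ A W :=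
  (re P _).monotone (hP.bigMeet_anti h ψ)

theorem conj_singleton_le (i : ι) : conj hP ψ (𝟙_ C) {i} ≤ ψ i := by
  rw [conj, toUnit_unique (toUnit (𝟙_ C)) (𝟙 _), re_id]
  exact hP.le_bigMeet.1 le_rfl i (Finset.mem_singleton_self i)

/-- This is entailment modulo finitely many axioms. The conjunction on the right-hand side of the
defining inequality can be dropped, since the left-hand side already lies below it. -/
theorem acl_le_iff {α β : Fib P A} :
    acl hP ψ α ≤ acl hP ψ β ↔ ∃ W : Finset ι, hP.meet α (conj hP ψ A W) ≤ β := by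
  constructor
  · rintro ⟨W, _, _, e⟩
    exact ⟨W, e.trans (hP.meet_le_left _ _)⟩
  · rintro ⟨W, e⟩
    exact ⟨W, W.empty_subset, W.empty_subset, hP.le_meet.2 ⟨e, hP.meet_le_right _ _⟩⟩

theorem acl_mono {α β : Fib P A} (h : α ≤ β) : acl hP ψ α ≤ acl hP ψ β :=
  ((toAxioms hP ψ).app A).monotone h

/-- An element of `P^𝒰(A)` and its underlying element of `P(A)`, seen at stage `∅`, agree once both
are met with the axioms of `𝒰`. Hence no new elements appear and only the order changes. -/
theorem exists_acl (α : Fib (addAxioms hP ψ) A) : ∃ β : Fib P A, α = acl hP ψ β := by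
  induction α using Antisymmetrization.ind with
  | _ α =>
    refine ⟨α.form, Quotient.sound ?_⟩
    exact ⟨⟨α.ax, subset_rfl, α.ax.empty_subset, le_rfl⟩,
      ⟨α.ax, α.ax.empty_subset, subset_rfl, le_rfl⟩⟩

theorem re_acl (f : A ⟶ B) (β : Fib P B) :
    re (addAxioms hP ψ) f (acl hP ψ β) = acl hP ψ (re P f β) := rfl

theorem acl_isTop {t : Fib P A} (ht : IsTop t) : IsTop (acl hP ψ t) := fun γ => by
  obtain ⟨γ, rfl⟩ := exists_acl hP ψ γ
  exact acl_mono hP ψ (ht γ)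

theorem acl_isBot {b : Fib P A} (hb : IsBot b) : IsBot (acl hP ψ b) := fun γ => by
  obtain ⟨γ, rfl⟩ := exists_acl hP ψ γ
  exact acl_mono hP ψ (hb γ)

theorem acl_isGLB {α β m : Fib P A} (hm : IsGLB {α, β} m) :
    IsGLB {acl hP ψ α, acl hP ψ β} (acl hP ψ m) := by
  classical
  obtain rfl := hm.unique (hP.meet_isGLB _ _)
  refine ⟨?_, fun γ hγ => ?_⟩
  · rintro _ (rfl | rfl)
    exacts [acl_mono hP ψ (hP.meet_le_left _ _), acl_mono hP ψ (hP.meet_le_right _ _)]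
  · have h₁ := hγ (Set.mem_insert _ _)
    have h₂ := hγ (Set.mem_insert_of_mem _ rfl)
    obtain ⟨γ, rfl⟩ := exists_acl hP ψ γ
    obtain ⟨W, h₁⟩ := (acl_le_iff hP ψ).1 h₁
    obtain ⟨V, h₂⟩ := (acl_le_iff hP ψ).1 h₂
    refine (acl_le_iff hP ψ).2 ⟨W ∪ V, hP.le_meet.2 ⟨le_trans ?_ h₁, le_trans ?_ h₂⟩⟩
    · exact hP.le_meet.2 ⟨hP.meet_le_left _ _,
        (hP.meet_le_right _ _).trans (conj_anti hP ψ Finset.subset_union_left)⟩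
    · exact hP.le_meet.2 ⟨hP.meet_le_left _ _,
        (hP.meet_le_right _ _).trans (conj_anti hP ψ Finset.subset_union_right)⟩

theorem isPrimary : IsPrimary (addAxioms hP ψ) where
  exists_top A := by
    obtain ⟨t, ht⟩ := hP.exists_top A
    exact ⟨_, acl_isTop hP ψ ht⟩
  exists_meet α β := by
    obtain ⟨α, rfl⟩ := exists_acl hP ψ α
    obtain ⟨β, rfl⟩ := exists_acl hP ψ β
    exact ⟨_, acl_isGLB hP ψ (hP.meet_isGLB α β)⟩
  re_top {A B} f t ht := by
    obtain ⟨s, hs⟩ := hP.exists_top B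
    obtain rfl := (acl_isTop hP ψ hs t).antisymm (ht _)
    exact acl_isTop hP ψ (hP.re_top f hs)
  re_meet f α β m hm := by
    obtain ⟨α, rfl⟩ := exists_acl hP ψ α
    obtain ⟨β, rfl⟩ := exists_acl hP ψ β
    obtain rfl := hm.unique (acl_isGLB hP ψ (hP.meet_isGLB α β))
    exact acl_isGLB hP ψ (hP.re_meet f (hP.meet_isGLB α β))

theorem acl_meet (α β : Fib P A) :
    (isPrimary hP ψ).meet (acl hP ψ α) (acl hP ψ β) = acl hP ψ (hP.meet α β) :=
  ((isPrimary hP ψ).meet_isGLB _ _).unique (acl_isGLB hP ψ (hP.meet_isGLB α β))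

/-- With the axioms `W` fixed, `(γ ∧ α) ∧ W ≤ β` is `(γ ∧ W) ∧ α ≤ β`, which is the adjunction in
`P` applied to `γ ∧ W`. -/
theorem acl_isImp {α β i : Fib P A} (hi : IsImp α β i) :
    IsImp (acl hP ψ α) (acl hP ψ β) (acl hP ψ i) := by
  refine (isImp_iff (isPrimary hP ψ)).2 fun γ => ?_
  obtain ⟨γ, rfl⟩ := exists_acl hP ψ γ
  rw [acl_meet, acl_le_iff, acl_le_iff]
  refine exists_congr fun W => ?_
  rw [hP.meet_right_comm]
  exact (isImp_iff hP).1 hi _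

/-- The axioms come from the terminal object, so their conjunction over `A ⊗ B` is reindexed from
`A`, and Frobenius reciprocity moves it out of the quantifier. -/
theorem acl_isEx (hE : IsExistential P) {α : Fib P (A ⊗ B)} {e : Fib P A} (he : IsEx P α e) :
    IsEx (addAxioms hP ψ) (acl hP ψ α) (acl hP ψ e) := by
  intro β
  obtain ⟨β, rfl⟩ := exists_acl hP ψ β
  rw [re_acl, acl_le_iff, acl_le_iff]
  refine exists_congr fun W => ?_
  rw [← re_conj hP ψ (fst A B)]
  exact hE.frobenius he (hP.meet_isGLB _ _) (hP.meet_isGLB _ _) β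

/-- No analogue of Frobenius is needed here: the axioms stand on the side of `β`, and reindexing
preserves meets. -/
theorem acl_isAll {α : Fib P (A ⊗ B)} {e : Fib P A} (he : IsAll P α e) :
    IsAll (addAxioms hP ψ) (acl hP ψ α) (acl hP ψ e) := by
  intro β
  obtain ⟨β, rfl⟩ := exists_acl hP ψ β
  rw [re_acl, acl_le_iff, acl_le_iff]
  refine exists_congr fun W => ?_
  rw [he, hP.re_meet_eq, re_conj]

theorem isImplicational (hI : IsImplicational P) : IsImplicational (addAxioms hP ψ) where
  toIsPrimary := isPrimary hP ψ
  exists_imp α β := by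
    obtain ⟨α, rfl⟩ := exists_acl hP ψ α
    obtain ⟨β, rfl⟩ := exists_acl hP ψ β
    exact ⟨_, acl_isImp hP ψ (hI.imp_isImp α β)⟩
  re_imp f α β i hi := by
    obtain ⟨α, rfl⟩ := exists_acl hP ψ α
    obtain ⟨β, rfl⟩ := exists_acl hP ψ β
    obtain rfl := hi.unique (isPrimary hP ψ) (acl_isImp hP ψ (hI.imp_isImp α β))
    exact acl_isImp hP ψ (hI.re_imp f (hI.imp_isImp α β))

theorem isExistential (hE : IsExistential P) : IsExistential (addAxioms hP ψ) where
  toIsPrimary := isPrimary hP ψ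
  exists_ex α := by
    obtain ⟨α, rfl⟩ := exists_acl hP ψ α
    exact ⟨_, acl_isEx hP ψ hE (hE.ex_isEx α)⟩
  beck_chevalley f α e he := by
    obtain ⟨α, rfl⟩ := exists_acl hP ψ α
    obtain rfl := he.unique (acl_isEx hP ψ hE (hE.ex_isEx α))
    exact acl_isEx hP ψ hE (hE.beck_chevalley f (hE.ex_isEx α))
  frobenius {A B} α m β e n he hm hn := by
    obtain ⟨α, rfl⟩ := exists_acl hP ψ α
    obtain ⟨β, rfl⟩ := exists_acl hP ψ β
    obtain rfl := he.unique (acl_isEx hP ψ hE (hE.ex_isEx α))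
    obtain rfl := hn.unique (acl_isGLB hP ψ (hP.meet_isGLB _ _))
    obtain rfl := hm.unique (acl_isGLB hP ψ (hP.meet_isGLB _ (re P (fst A B) β)))
    exact acl_isEx hP ψ hE (hE.frobenius (hE.ex_isEx α) (hP.meet_isGLB _ _) (hP.meet_isGLB _ _))

theorem isUniversal (hU : IsUniversal P) : IsUniversal (addAxioms hP ψ) where
  exists_all α := by
    obtain ⟨α, rfl⟩ := exists_acl hP ψ α
    obtain ⟨e, he⟩ := hU.exists_all α
    exact ⟨_, acl_isAll hP ψ he⟩
  beck_chevalley f α e he := by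
    obtain ⟨α, rfl⟩ := exists_acl hP ψ α
    obtain ⟨e, he'⟩ := hU.exists_all α
    obtain rfl := he.unique (acl_isAll hP ψ he')
    exact acl_isAll hP ψ (hU.beck_chevalley f he')

theorem isBounded (hB : IsBounded P) : IsBounded (addAxioms hP ψ) where
  exists_top := (isPrimary hP ψ).exists_top
  exists_bot A := by
    obtain ⟨b, hb⟩ := hB.exists_bot A
    exact ⟨_, acl_isBot hP ψ hb⟩
  re_top := (isPrimary hP ψ).re_top
  re_bot {A B} f b hb := by
    obtain ⟨s, hs⟩ := hB.exists_bot B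
    obtain rfl := (acl_isBot hP ψ hs b).antisymm' (hb _)
    exact acl_isBot hP ψ (hB.re_bot f hs)

theorem isFiberedEq {δ : ∀ A : C, Fib P (A ⊗ A)} (h : IsFiberedEq P δ) :
    IsFiberedEq (addAxioms hP ψ) fun A => acl hP ψ (δ A) where
  refl A := acl_isTop hP ψ (h.refl A)
  subst {A} α m hm := by
    obtain ⟨α, rfl⟩ := exists_acl hP ψ α
    obtain rfl := hm.unique (acl_isGLB hP ψ (hP.meet_isGLB (re P (fst A A) α) (δ A)))
    exact acl_mono hP ψ (h.subst α (hP.meet_isGLB _ _))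
  prod {A B} m hm := by
    obtain rfl := hm.unique (acl_isGLB hP ψ (hP.meet_isGLB (re P (fst A B ⊗ₘ fst A B) (δ A))
      (re P (snd A B ⊗ₘ snd A B) (δ B))))
    exact acl_mono hP ψ (h.prod (hP.meet_isGLB _ _))

end addAxioms

end AddAxiomsStructure


theorem DoctrineHom.appProd_re_whiskerRight {C : Type u} [Category.{v} C]
    [CartesianMonoidalCategory C] {D : Type u₂} [Category.{v₂} D] [CartesianMonoidalCategory D]
    {P : Cᵒᵖ ⥤ PartOrd.{w}} {R : Dᵒᵖ ⥤ PartOrd.{w₂}} (G : DoctrineHom P R) {A A' B : C}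
    (s : A ⟶ A') (α : Fib P (A' ⊗ B)) :
    G.appProd (re P (s ▷ B) α) =
      re R (G.functor.map s ▷ G.functor.obj B) (G.appProd α) := by
  rw [appProd, appProd, G.naturality, ← re_comp, prodComparison_inv_natural_whiskerRight, re_comp]

open addConst addAxioms ConstBase

/-! ### The doctrine `P⃗` and the morphism from `P` to it. -/

namespace Listing

variable {C : Type u} [Category.{v} C] [CartesianMonoidalCategory C] {P : Cᵒᵖ ⥤ PartOrd.{w}}
  (L : Listing P) (hI : IsImplicational P) (hE : IsExistential P) {A B : C}

/-- The class `[[φ, Z̄], ∅]` of `φ ∈ P(ΠZ̄ × A)`. -/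
noncomputable def rcls (Z : Ctx C (Label P)) (φ : Fib P (Z.prod ⊗ A)) :
    Fib (L.rich hI hE) ⟨A⟩ :=
  acl (hI.toIsPrimary.addConst (Label P)) (L.henkinAx hI hE) (fcls Z φ)

/-- The class `[[α, ∅], ∅]` of `α ∈ P(A)`. -/
noncomputable def tcls (α : Fib P A) : Fib (L.rich hI hE) ⟨A⟩ := (L.toRich hI hE).app A α

theorem tcls_eq_rcls (Z : Ctx C (Label P)) (α : Fib P A) :
    L.tcls hI hE α = L.rcls hI hE Z (re P (snd _ _) α) :=
  congrArg (acl (hI.toIsPrimary.addConst (Label P)) (L.henkinAx hI hE)) (ccls_eq_fcls Z α)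

/-- The arrow `A ⇢ ΠZ̄ × A` given by the constants of `Z̄`. -/
noncomputable def sec (Z : Ctx C (Label P)) (A : C) :
    (⟨A⟩ : ConstBase C (Label P)) ⟶ ⟨Z.prod ⊗ A⟩ := acls Z (𝟙 _)

/-- Every element of `P⃗` is an element of `P` with constants substituted. The value of a morphism
on it is thus determined by the restriction to `P` and the images of the constants. -/
theorem rcls_eq_re (Z : Ctx C (Label P)) (φ : Fib P (Z.prod ⊗ A)) :
    L.rcls hI hE Z φ = re (L.rich hI hE) (sec Z A) (L.tcls hI hE φ) := by
  refine congrArg (acl (hI.toIsPrimary.addConst (Label P)) (L.henkinAx hI hE)) ?_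
  refine Eq.trans ?_ (re_acls_ccls Z (𝟙 _) φ).symm
  rw [re_id]

theorem exists_rcls (α : Fib (L.rich hI hE) ⟨A⟩) :
    ∃ (Z : Ctx C (Label P)) (φ : Fib P (Z.prod ⊗ A)), α = L.rcls hI hE Z φ := by
  obtain ⟨α, rfl⟩ := exists_acl _ _ α
  obtain ⟨Z, φ, rfl⟩ := exists_fcls α
  exact ⟨Z, φ, rfl⟩

theorem exists_rcls₂ (α : Fib (L.rich hI hE) ⟨A⟩) (β : Fib (L.rich hI hE) ⟨B⟩) :
    ∃ (Z : Ctx C (Label P)) (φ : Fib P (Z.prod ⊗ A)) (ψ : Fib P (Z.prod ⊗ B)),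
      α = L.rcls hI hE Z φ ∧ β = L.rcls hI hE Z ψ := by
  obtain ⟨α, rfl⟩ := exists_acl _ _ α
  obtain ⟨β, rfl⟩ := exists_acl _ _ β
  obtain ⟨Z, φ, ψ, rfl, rfl⟩ := exists_fcls₂ α β
  exact ⟨Z, φ, ψ, rfl, rfl⟩

theorem rich_isPrimary : IsPrimary (L.rich hI hE) := addAxioms.isPrimary _ _

theorem rich_isImplicational : IsImplicational (L.rich hI hE) :=
  addAxioms.isImplicational _ _ (hI.addConst _)

theorem rich_isExistential : IsExistential (L.rich hI hE) :=
  addAxioms.isExistential _ _ (hE.addConst _)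

theorem rich_isUniversal (hU : IsUniversal P) : IsUniversal (L.rich hI hE) :=
  addAxioms.isUniversal _ _ (hU.addConst _)

theorem rich_isBounded (hB : IsBounded P) : IsBounded (L.rich hI hE) :=
  addAxioms.isBounded _ _ (hB.addConst _)

theorem rich_isFiberedEq {δ : ∀ A : C, Fib P (A ⊗ A)} (h : IsFiberedEq P δ) :
    IsFiberedEq (L.rich hI hE) fun A : ConstBase C (Label P) => (L.tcls hI hE (δ A.of) :) :=
  addAxioms.isFiberedEq _ _ (h.addConst _ hI.toIsPrimary)

theorem rcls_isGLB (Z : Ctx C (Label P)) {φ ψ m : Fib P (Z.prod ⊗ A)} (hm : IsGLB {φ, ψ} m) :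
    IsGLB {L.rcls hI hE Z φ, L.rcls hI hE Z ψ} (L.rcls hI hE Z m) :=
  acl_isGLB _ _ (fcls_isGLB Z hI.toIsPrimary hm)

theorem rcls_isImp (Z : Ctx C (Label P)) {φ ψ i : Fib P (Z.prod ⊗ A)} (hi : IsImp φ ψ i) :
    IsImp (L.rcls hI hE Z φ) (L.rcls hI hE Z ψ) (L.rcls hI hE Z i) :=
  acl_isImp _ _ (fcls_isImp Z hI hi)

theorem rcls_isEx (Z : Ctx C (Label P)) {φ : Fib P (Z.prod ⊗ (A ⊗ B))}
    {e : Fib P (Z.prod ⊗ A)} (he : IsEx P (re P (α_ Z.prod A B).hom φ) e) :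
    IsEx (L.rich hI hE) (D := ⟨A⟩) (B := ⟨B⟩) (L.rcls hI hE (A := A ⊗ B) Z φ)
      (L.rcls hI hE Z e) :=
  acl_isEx _ _ (hE.addConst _) (fcls_isEx Z hE he)

theorem rcls_isAll (hU : IsUniversal P) (Z : Ctx C (Label P)) {φ : Fib P (Z.prod ⊗ (A ⊗ B))}
    {e : Fib P (Z.prod ⊗ A)} (he : IsAll P (re P (α_ Z.prod A B).hom φ) e) :
    IsAll (L.rich hI hE) (D := ⟨A⟩) (B := ⟨B⟩) (L.rcls hI hE (A := A ⊗ B) Z φ)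
      (L.rcls hI hE Z e) :=
  acl_isAll _ _ (fcls_isAll Z hU he)

theorem tcls_isTop {t : Fib P A} (ht : IsTop t) : IsTop (L.tcls hI hE t) :=
  acl_isTop _ _ (top_isTop hI.toIsPrimary ht)

theorem tcls_isBot (hB : IsBounded P) {b : Fib P A} (hb : IsBot b) : IsBot (L.tcls hI hE b) := by
  rw [tcls_eq_rcls L hI hE Ctx.empty]
  exact acl_isBot _ _ (fcls_isBot _ hB.re_bot (hB.re_bot _ hb))

theorem tcls_isGLB {α β m : Fib P A} (hm : IsGLB {α, β} m) :
    IsGLB {L.tcls hI hE α, L.tcls hI hE β} (L.tcls hI hE m) := by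
  simp only [tcls_eq_rcls L hI hE Ctx.empty]
  exact rcls_isGLB L hI hE _ (hI.re_meet _ hm)

theorem tcls_isImp {α β i : Fib P A} (hi : IsImp α β i) :
    IsImp (L.tcls hI hE α) (L.tcls hI hE β) (L.tcls hI hE i) := by
  simp only [tcls_eq_rcls L hI hE Ctx.empty]
  exact rcls_isImp L hI hE _ (hI.re_imp _ hi)

/-- Over the empty list, `α` is reindexed along a projection that forgets the factor `Π∅`;
Beck–Chevalley along that projection gives the claim. -/
theorem tcls_isEx {α : Fib P (A ⊗ B)} {e : Fib P A} (he : IsEx P α e) :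
    IsEx (L.rich hI hE) (D := ⟨A⟩) (B := ⟨B⟩) (L.tcls hI hE (A := A ⊗ B) α)
      (L.tcls hI hE e) := by
  rw [tcls_eq_rcls L hI hE Ctx.empty e, tcls_eq_rcls L hI hE Ctx.empty α]
  refine rcls_isEx L hI hE _ ?_
  rw [← re_comp, show (α_ _ A B).hom ≫ snd _ (A ⊗ B) =
    snd (Ctx.empty : Ctx C (Label P)).prod A ▷ B by ext <;> simp]
  exact hE.beck_chevalley _ he

theorem toRich_appProd (α : Fib P (A ⊗ B)) :
    (L.toRich hI hE).appProd α = L.tcls hI hE α := by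
  have e : CartesianMonoidalCategory.prodComparison (L.toRich hI hE).functor A B = 𝟙 _ :=
    prodComparison_incl A B
  have e' : inv (CartesianMonoidalCategory.prodComparison (L.toRich hI hE).functor A B) = 𝟙 _ :=
    IsIso.inv_eq_of_hom_inv_id (by rw [e]; exact Category.comp_id _)
  rw [DoctrineHom.appProd, e']
  exact re_id _ _

theorem toRich_isPrimary : (L.toRich hI hE).IsPrimary where
  source := hI.toIsPrimary
  target := L.rich_isPrimary hI hE
  top := L.tcls_isTop hI hE
  meet := L.tcls_isGLB hI hE

theorem toRich_isImplicational : (L.toRich hI hE).IsImplicational where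
  source := hI
  target := L.rich_isImplicational hI hE
  primary := L.toRich_isPrimary hI hE
  imp := L.tcls_isImp hI hE

theorem toRich_isExistential : (L.toRich hI hE).IsExistential where
  source := hE
  target := L.rich_isExistential hI hE
  primary := L.toRich_isPrimary hI hE
  ex he := by
    rw [toRich_appProd]
    exact L.tcls_isEx hI hE he

/-! ### Morphisms out of `P⃗` inherit structure from their restriction to `P`. -/

section Extension

variable {D : Type u₂} [Category.{v₂} D] [CartesianMonoidalCategory D] {R : Dᵒᵖ ⥤ PartOrd.{w₂}}
  (G : DoctrineHom (L.rich hI hE) R)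

theorem app_rcls (Z : Ctx C (Label P)) (φ : Fib P (Z.prod ⊗ A)) :
    G.app ⟨A⟩ (L.rcls hI hE Z φ) =
      re R (G.functor.map (sec Z A)) (((L.toRich hI hE).comp G).app _ φ) := by
  rw [rcls_eq_re, G.naturality]
  rfl

theorem sec_whiskerRight (Z : Ctx C (Label P)) (A B : C) :
    sec Z A ▷ (⟨B⟩ : ConstBase C (Label P)) = acls Z (α_ Z.prod A B).inv := by
  refine (acls_whiskerRight Z (𝟙 _) B).trans ?_
  congr 1
  apply CartesianMonoidalCategory.hom_ext
  · apply CartesianMonoidalCategory.hom_ext <;> simp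
  · simp

theorem rcls_eq_re_whiskerRight (Z : Ctx C (Label P)) (φ : Fib P (Z.prod ⊗ (A ⊗ B))) :
    L.rcls hI hE Z φ = re (L.rich hI hE) (sec Z A ▷ (⟨B⟩ : ConstBase C (Label P)))
      (L.tcls hI hE (re P (α_ Z.prod A B).hom φ)) := by
  rw [sec_whiskerRight]
  refine congrArg (acl (hI.toIsPrimary.addConst (Label P)) (L.henkinAx hI hE)) ?_
  refine Eq.trans ?_ (re_acls_ccls Z (α_ Z.prod A B).inv (re P (α_ Z.prod A B).hom φ)).symm
  rw [← re_comp, Iso.inv_hom_id, re_id]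

/-- The constants occur only in the factor that is not quantified, so they enter through an arrow
whiskered with `B`. This is the form in which Beck–Chevalley in `R` applies. -/
theorem appProd_rcls (Z : Ctx C (Label P)) (φ : Fib P (Z.prod ⊗ (A ⊗ B))) :
    G.appProd (A := ⟨A⟩) (B := ⟨B⟩) (L.rcls hI hE (A := A ⊗ B) Z φ) =
      re R (G.functor.map (sec Z A) ▷ G.functor.obj ⟨B⟩)
        (((L.toRich hI hE).comp G).appProd (re P (α_ Z.prod A B).hom φ)) := by
  exact (congrArg (G.appProd (A := ⟨A⟩) (B := ⟨B⟩)) (L.rcls_eq_re_whiskerRight hI hE Z φ)).trans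
    (G.appProd_re_whiskerRight (B := ⟨B⟩) (sec Z A) _)

variable {L hI hE G}

/-- The pattern for all the preservation lemmas: represent the data over one `Z`, compute the
operation in `P`, apply the composite, and reindex in `R` along the image of the section `sec Z A`,
which respects the operation. -/
theorem isPrimary_of_comp (h : ((L.toRich hI hE).comp G).IsPrimary) : G.IsPrimary where
  source := L.rich_isPrimary hI hE
  target := h.target
  top {A t} ht := by
    obtain ⟨A⟩ := A
    obtain ⟨s, hs⟩ := hI.exists_top A
    obtain rfl := (L.tcls_isTop hI hE hs t).antisymm (ht _)
    exact h.top hs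
  meet {A α β m} hm := by
    obtain ⟨A⟩ := A
    obtain ⟨Z, φ, ψ, rfl, rfl⟩ := L.exists_rcls₂ hI hE α β
    have k := hI.toIsPrimary.meet_isGLB φ ψ
    obtain rfl := hm.unique (L.rcls_isGLB hI hE Z k)
    simp only [app_rcls]
    exact h.target.re_meet _ (h.meet k)

theorem isImplicational_of_comp (h : ((L.toRich hI hE).comp G).IsImplicational) :
    G.IsImplicational where
  source := L.rich_isImplicational hI hE
  target := h.target
  primary := isPrimary_of_comp h.primary
  imp {A α β i} hi := by
    obtain ⟨A⟩ := A
    obtain ⟨Z, φ, ψ, rfl, rfl⟩ := L.exists_rcls₂ hI hE α β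
    have k := hI.imp_isImp φ ψ
    obtain rfl := hi.unique (L.rich_isPrimary hI hE) (L.rcls_isImp hI hE Z k)
    simp only [app_rcls]
    exact h.target.re_imp _ (h.imp k)

theorem isExistential_of_comp (h : ((L.toRich hI hE).comp G).IsExistential) :
    G.IsExistential where
  source := L.rich_isExistential hI hE
  target := h.target
  primary := isPrimary_of_comp h.primary
  ex {A B α e} he := by
    obtain ⟨A⟩ := A
    obtain ⟨B⟩ := B
    obtain ⟨Z, φ, rfl⟩ := L.exists_rcls hI hE (A := A ⊗ B) α
    have k := hE.ex_isEx (re P (α_ Z.prod A B).hom φ)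
    obtain rfl := he.unique (L.rcls_isEx hI hE Z k)
    rw [app_rcls, appProd_rcls]
    exact h.target.beck_chevalley _ (h.ex k)

theorem isUniversal_of_comp (h : ((L.toRich hI hE).comp G).IsUniversal) :
    G.IsUniversal where
  source := L.rich_isUniversal hI hE h.source
  target := h.target
  all {A B α e} he := by
    obtain ⟨A⟩ := A
    obtain ⟨B⟩ := B
    obtain ⟨Z, φ, rfl⟩ := L.exists_rcls hI hE (A := A ⊗ B) α
    obtain ⟨e, k⟩ := h.source.exists_all (re P (α_ Z.prod A B).hom φ)
    obtain rfl := he.unique (L.rcls_isAll hI hE h.source Z k)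
    rw [app_rcls, appProd_rcls]
    exact h.target.beck_chevalley _ (h.all k)

theorem isBounded_of_comp (h : ((L.toRich hI hE).comp G).IsBounded) : G.IsBounded where
  source := L.rich_isBounded hI hE h.source
  target := h.target
  top {A t} ht := by
    obtain ⟨A⟩ := A
    obtain ⟨s, hs⟩ := hI.exists_top A
    obtain rfl := (L.tcls_isTop hI hE hs t).antisymm (ht _)
    exact h.top hs
  bot {A b} hb := by
    obtain ⟨A⟩ := A
    obtain ⟨s, hs⟩ := h.source.exists_bot A
    obtain rfl := (hb _).antisymm (L.tcls_isBot hI hE h.source hs b)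
    exact h.bot hs

theorem isElementary_of_comp (h : ((L.toRich hI hE).comp G).IsElementary) : G.IsElementary where
  source := 
    { toIsPrimary := L.rich_isPrimary hI hE
      exists_eq := by
        obtain ⟨δ, hδ⟩ := h.source.exists_eq
        exact ⟨_, L.rich_isFiberedEq hI hE hδ⟩ }
  target := h.target
  primary := isPrimary_of_comp h.primary
  eq {δ' ε} hδ' hε A := by
    obtain ⟨A⟩ := A
    obtain ⟨δ, hδ⟩ := h.source.exists_eq
    -- The fibered equality of `P⃗` is unique, hence consists of the classes of `δ`. The remaining
    -- equation is definitionally the one for the composite, as `C̲` has the products of `C`.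
    obtain rfl := hδ'.unique (L.rich_isFiberedEq hI hE hδ) (L.rich_isPrimary hI hE)
    exact h.eq hδ hε A

end Extension

end Listing


open addConst addAxioms ConstBase

/-! ### Richness of `P⃗`. -/

namespace Listing

variable {C : Type u} [Category.{v} C] [CartesianMonoidalCategory C] {P : Cᵒᵖ ⥤ PartOrd.{w}}
  (L : Listing P) (hI : IsImplicational P) (hE : IsExistential P) {A B : C}

theorem ctx_le_ctxStar (B : C) (j : Label P) : L.ctx B j ≤ L.ctxStar B j :=
  Ctx.le_snoc _ _ (L.wit_notMem B j)

theorem wit_mem_ctxStar (B : C) (j : Label P) : (B, L.wit B j) ∈ (L.ctxStar B j).1 := by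
  simp [ctxStar, Ctx.snoc]

/-- The projection `ΠX̄_⋆ × t ⟶ ΠX̄ × B` that forms the axiom for `(B, j)`. -/
noncomputable def axArr (B : C) (j : Label P) :
    (L.ctxStar B j).prod ⊗ 𝟙_ C ⟶ (L.ctx B j).prod ⊗ B :=
  fst _ _ ≫ lift (Ctx.restr (L.ctx_le_ctxStar B j))
    ((L.ctxStar B j).proj (B, L.wit B j) (L.wit_mem_ctxStar B j))

theorem henkinAx_eq (B : C) (j : Label P) : L.henkinAx hI hE (B, j) =
    fcls (L.ctxStar B j) (re P (L.axArr B j) (L.axForm hI hE B j)) := rfl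

theorem rcls_mono {Z W : Ctx C (Label P)} (h : Z ≤ W) (φ : Fib P (Z.prod ⊗ A)) :
    L.rcls hI hE Z φ = L.rcls hI hE W (re P (Ctx.restr h ▷ A) φ) :=
  congrArg (acl (hI.toIsPrimary.addConst (Label P)) (L.henkinAx hI hE)) (fcls_mono h φ)

theorem re_acls_rcls (Z : Ctx C (Label P)) (f : Z.prod ⊗ A ⟶ B) (ψ : Fib P (Z.prod ⊗ B)) :
    re (L.rich hI hE) (acls Z f) (L.rcls hI hE Z ψ) =
      L.rcls hI hE Z (re P (lift (fst _ _) f) ψ) :=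
  congrArg (acl (hI.toIsPrimary.addConst (Label P)) (L.henkinAx hI hE)) (re_acls Z f ψ)

theorem re_iota_rcls (Z : Ctx C (Label P)) (f : A ⟶ B) (ψ : Fib P (Z.prod ⊗ B)) :
    re (L.rich hI hE) (iota _ f) (L.rcls hI hE Z ψ) = L.rcls hI hE Z (re P (Z.prod ◁ f) ψ) :=
  congrArg (acl (hI.toIsPrimary.addConst (Label P)) (L.henkinAx hI hE)) (re_iota Z f ψ)

/-- A derivation that uses only the axiom for `(B, j)`: the finite set of axioms is the singleton of
this pair. -/
theorem le_of_henkinAx {B : C} {j : Label P} {a b : Fib P ((L.ctxStar B j).prod ⊗ 𝟙_ C)}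
    (h : hI.toIsPrimary.meet a (re P (L.axArr B j) (L.axForm hI hE B j)) ≤ b) :
    L.rcls hI hE _ a ≤ L.rcls hI hE _ b := by
  have hQ := hI.toIsPrimary.addConst (Label P)
  refine (acl_le_iff hQ (L.henkinAx hI hE)).2 ⟨{(B, j)}, le_trans ?_ (fcls_le h)⟩
  rw [← fcls_meet]
  refine hQ.le_meet.2 ⟨hQ.meet_le_left _ _, (hQ.meet_le_right _ _).trans ?_⟩
  exact conj_singleton_le hQ (L.henkinAx hI hE) (B, j)

/-- The constant `t ⇢ B` named by the label `d^B_j`. -/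
noncomputable def witArr (B : C) (j : Label P) : (⟨𝟙_ C⟩ : ConstBase C (Label P)) ⟶ ⟨B⟩ :=
  acls (L.ctxStar B j) (fst _ _ ≫ (L.ctxStar B j).proj (B, L.wit B j) (L.wit_mem_ctxStar B j))

/-- Over the list enlarged by `(A, d^A_j)`, this is modus ponens with the Henkin axiom `∃φ → φ`,
evaluated at the new constant. -/
theorem rcls_ex_le (A : C) (j : Label P) :
    L.rcls hI hE (L.ctx A j) (re P (fst _ (𝟙_ C)) (hE.ex (L.form A j))) ≤
      re (L.rich hI hE) (L.witArr A j) (L.rcls hI hE (L.ctx A j) (L.form A j)) := by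
  rw [L.rcls_mono hI hE (L.ctx_le_ctxStar A j), L.rcls_mono hI hE (L.ctx_le_ctxStar A j),
    witArr, re_acls_rcls]
  apply L.le_of_henkinAx hI hE
  have e₁ : Ctx.restr (L.ctx_le_ctxStar A j) ▷ 𝟙_ C ≫ fst _ _ = L.axArr A j ≫ fst _ _ := by
    rw [whiskerRight_fst, axArr, Category.assoc, lift_fst]
  have e₂ : lift (fst _ _) (fst _ (𝟙_ C) ≫ (L.ctxStar A j).proj (A, L.wit A j)
      (L.wit_mem_ctxStar A j)) ≫ Ctx.restr (L.ctx_le_ctxStar A j) ▷ A = L.axArr A j := by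
    apply CartesianMonoidalCategory.hom_ext <;> simp [axArr]
  rw [← re_comp, ← re_comp, e₁, e₂, re_comp, ← hI.toIsPrimary.re_meet_eq]
  refine (re P _).monotone ?_
  have h := (isImp_iff hI.toIsPrimary).1 (hI.imp_isImp (re P (fst _ _) (hE.ex (L.form A j)))
    (L.form A j)) (L.axForm hI hE A j)
  exact le_trans (hI.toIsPrimary.le_meet.2 ⟨hI.toIsPrimary.meet_le_right _ _,
    hI.toIsPrimary.meet_le_left _ _⟩) (h.1 le_rfl)

theorem rich_isRich : IsRich (L.rich hI hE) where
  toIsExistential := L.rich_isExistential hI hE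
  exists_witness {A} σ := by
    obtain ⟨A⟩ := A
    obtain ⟨σ, rfl⟩ := exists_acl _ _ σ
    -- The listing exhausts `P̲(A)`, so `σ` has an index `j` and the constant reserved for that
    -- index is the witness.
    obtain ⟨j, rfl⟩ := L.surjective A σ
    refine ⟨L.witArr A j, fun e he => ?_⟩
    -- Richness quantifies `σ` over `t × A`, whereas the axiom quantifies over `ΠX̄ × A`;
    -- Beck–Chevalley along `ΠX̄ × t ⟶ ΠX̄` identifies the two.
    have k := L.rcls_isEx hI hE (A := 𝟙_ C) (B := A) (L.ctx A j)
      (φ := re P ((L.ctx A j).prod ◁ snd (𝟙_ C) A) (L.form A j))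
      (e := re P (fst _ _) (hE.ex (L.form A j))) (by
        rw [← re_comp, show (α_ _ _ _).hom ≫ (L.ctx A j).prod ◁ snd (𝟙_ C) A =
          fst (L.ctx A j).prod (𝟙_ C) ▷ A by ext <;> simp]
        exact hE.beck_chevalley _ (hE.ex_isEx (L.form A j)))
    rw [← re_iota_rcls] at k
    obtain rfl := IsEx.unique he k
    exact L.rcls_ex_le hI hE A j

end Listing


open addConst ConstBase

/-! ### Over a finite doctrine, evaluation does not depend on the point. -/

section FiniteIndependence

variable {C : Type u} [Category.{v} C] [CartesianMonoidalCategory C] {P : Cᵒᵖ ⥤ PartOrd.{w}}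

/-- The object `T × Z × Zⁿ`. -/
def tensorPow (T Z : C) : ℕ → C
  | 0 => T ⊗ Z
  | n + 1 => tensorPow T Z n ⊗ Z

/-- Every power has an arrow to `Z`, because the recursion starts at `T ⊗ Z`. The last clause
factors a given `h` through the power, which is possible once some arrow `S ⟶ Z` exists. -/
theorem exists_tensorPow_proj (T Z : C) (n : ℕ) : ∃ (t : tensorPow T Z n ⟶ T)
    (_ : tensorPow T Z n ⟶ Z), ∀ {S : C} (h : S ⟶ T) (_ : S ⟶ Z), ∃ k, k ≫ t = h := by
  induction n with
  | zero => exact ⟨fst T Z, snd T Z, fun h f => ⟨lift h f, lift_fst _ _⟩⟩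
  | succ n ih =>
    obtain ⟨t, q, H⟩ := ih
    refine ⟨fst (tensorPow T Z n) Z ≫ t, snd (tensorPow T Z n) Z, fun h f => ?_⟩
    obtain ⟨k, hk⟩ := H h f
    exact ⟨lift k f, (lift_fst_assoc _ _ _).trans hk⟩

/-- An arrow `Y ⟶ Z` provides a section of the projection. Without one, the fiber over `Y` could
collapse when a variable is added. -/
theorem re_fst_injective {Y Z : C} (q : Y ⟶ Z) : Function.Injective (re P (fst Y Z)) := by
  intro α β h
  have h := congrArg (re P (lift (𝟙 Y) q)) h
  rwa [← re_comp, ← re_comp, lift_fst, re_id, re_id] at h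

/-- If there are only finitely many objects and the fibers are finite, then elements of the fibers
do not depend on the choice of the points at which they are evaluated. -/
theorem re_lift_eq_of_finite [Finite C] [∀ A : C, Finite (Fib P A)] {S T Z : C} (h : S ⟶ T)
    (f g : S ⟶ Z) (φ : Fib P (T ⊗ Z)) : re P (lift h f) φ = re P (lift h g) φ := by
  have inj (n : ℕ) : Function.Injective (re P (fst (tensorPow T Z n) Z)) :=
    re_fst_injective (exists_tensorPow_proj T Z n).choose_spec.choose
  have mono : Monotone fun n => Nat.card (Fib P (tensorPow T Z n)) :=
    monotone_nat_of_le_succ fun n => Nat.card_le_card_of_injective _ (inj n)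
  -- Pigeonhole on objects: two powers coincide. The cardinalities of the fibers increase with `n`
  -- and agree at `n` and `m`, so they agree at `n` and `n + 1`, and the injection between those two
  -- fibers is onto.
  obtain ⟨n, m, hnm, e⟩ : ∃ n m, n < m ∧ tensorPow T Z n = tensorPow T Z m := by
    obtain ⟨n, m, hnm, e⟩ := Finite.exists_ne_map_eq_of_infinite (tensorPow T Z)
    rcases lt_or_gt_of_ne hnm with h | h
    exacts [⟨n, m, h, e⟩, ⟨m, n, h, e.symm⟩]
  have surj : Function.Surjective (re P (fst (tensorPow T Z n) Z)) :=
    ((inj n).bijective_of_nat_card_le ((mono (Nat.succ_le_of_lt hnm)).trans_eq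
      (congrArg (fun Y => Nat.card (Fib P Y)) e.symm))).2
  obtain ⟨t, -, H⟩ := exists_tensorPow_proj T Z n
  obtain ⟨k, rfl⟩ := H h f
  -- `φ`, with extra dummy variables, is reindexed from an element `χ` in which the last variable
  -- does not occur.
  obtain ⟨χ, hχ⟩ := surj (re P (t ▷ Z) φ)
  have key (f : S ⟶ Z) : re P (lift (k ≫ t) f) φ = re P k χ := by
    have e := congrArg (re P (lift k f)) hχ
    rw [← re_comp, ← re_comp, lift_fst, lift_whiskerRight] at e
    exact e.symm
  rw [key f, key g]

end FiniteIndependence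

/-! ### Existence of admissible listings. -/

section Existence

variable {C : Type u} [Category.{v} C] [CartesianMonoidalCategory C] {P : Cᵒᵖ ⥤ PartOrd.{w}}

theorem nonempty_label_equiv (P : Cᵒᵖ ⥤ PartOrd.{w}) : Nonempty (Label P ≃ Σ X : C, Fib P X) :=
  Cardinal.eq.1 (Cardinal.mk_ord_toType _)

/-- A listing exists as soon as every `P̲(B)` can be listed so that the labels occurring at
position `j` are below `j`. -/
theorem Listing.nonempty_of_forall
    (H : ∀ B : C, ∃ f : Label P → FormRep P (Label P) B, (∀ j, ∀ y ∈ (f j).ctx.1, y.2 < j) ∧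
      ∀ α : Fib (addConst P (Label P)) ⟨B⟩, ∃ j, α = addConst.cls (A := ⟨B⟩) (f j)) :
    Nonempty (Listing P) := by
  choose f hf hs using H
  exact ⟨{
    ctx := fun B j => (f B j).ctx
    form := fun B j => (f B j).form
    surjective := hs
    -- The bound on labels makes `d^B_j = j`: it exceeds the earlier `d^B_h = h` and all labels up
    -- to position `j`, while a smaller `o` would have to exceed `d^B_o = o`.
    wit := fun _ j => j
    wit_isLeast := fun B j => ⟨⟨fun _ h => h, fun k hk y hy => (hf B k y hy).trans_le hk⟩,
      fun o ho => le_of_not_gt fun h => lt_irrefl _ (ho.1 o h)⟩ }⟩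

theorem nonempty_equiv_prod (α : Type x) [Infinite α] : Nonempty (α ≃ α × α) :=
  Cardinal.eq.1 (by simp)

theorem nonempty_list_prod_equiv (α : Type x) [Infinite α] :
    Nonempty (List (α × α) × α ≃ α) :=
  Cardinal.eq.1 (by rw [Cardinal.mk_prod, Cardinal.mk_list_eq_mk]; simp)

/-- There are at most `Λ` representatives, and pairing positions with `Λ × Λ` makes each of them
recur `Λ` many times. At a position that is too early for the labels involved, the top element is
listed instead. -/
theorem exists_listing_of_infinite (hP : IsPrimary P) [Infinite (Label P)] (B : C) :
    ∃ f : Label P → FormRep P (Label P) B, (∀ j, ∀ y ∈ (f j).ctx.1, y.2 < j) ∧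
      ∀ α : Fib (addConst P (Label P)) ⟨B⟩, ∃ j, α = addConst.cls (A := ⟨B⟩) (f j) := by
  classical
  choose t ht using hP.exists_top
  have e := (nonempty_label_equiv P).some
  -- An object `X` is coded by the top element of its fiber, so lists of entries become lists over
  -- `Λ × Λ`.
  let g : FormRep P (Label P) B → List (Label P × Label P) × Label P := fun φ =>
    (φ.ctx.1.map fun y => (e.symm ⟨y.1, t y.1⟩, y.2), e.symm ⟨_, φ.form⟩)
  have hg : Function.Injective g := by
    rintro ⟨⟨X, hX⟩, φ⟩ ⟨⟨Y, hY⟩, ψ⟩ h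
    have h₁ := congrArg Prod.fst h
    have h₂ := congrArg Prod.snd h
    have hi : Function.Injective fun y : C × Label P => (e.symm ⟨y.1, t y.1⟩, y.2) := by
      rintro ⟨a, b⟩ ⟨c, d⟩ h
      obtain ⟨h₁, h₂⟩ := Prod.mk.inj h
      exact Prod.ext (congrArg Sigma.fst (e.symm.injective h₁)) h₂
    obtain rfl : X = Y := List.map_injective_iff.2 hi h₁
    have h₃ := eq_of_heq (Sigma.mk.inj (e.symm.injective h₂)).2
    exact congrArg (FormRep.mk _) h₃
  obtain ⟨i⟩ := nonempty_list_prod_equiv (Label P)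
  obtain ⟨p⟩ := nonempty_equiv_prod (Label P)
  have : Nonempty (FormRep P (Label P) B) := ⟨FormRep.const _ (t B)⟩
  let s : Label P → FormRep P (Label P) B := Function.invFun (i ∘ g)
  have hs : Function.Surjective s := Function.invFun_surjective (i.injective.comp hg)
  refine ⟨fun j => if ∀ y ∈ (s (p j).1).ctx.1, y.2 < j then s (p j).1
    else FormRep.const _ (t B), fun j y hy => ?_, fun α => ?_⟩
  · beta_reduce at hy
    split_ifs at hy with h
    · exact h y hy
    · exact absurd hy List.not_mem_nil
  · obtain ⟨φ, rfl⟩ := addConst.exists_cls α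
    obtain ⟨a, rfl⟩ := hs φ
    have hω : Cardinal.aleph0 ≤ Cardinal.mk (Σ X : C, Fib P X) := by
      rw [← Cardinal.mk_ord_toType (Cardinal.mk (Σ X : C, Fib P X))]
      exact Cardinal.aleph0_le_mk (Label P)
    have := Cardinal.noMaxOrder hω
    obtain ⟨m, hm⟩ : ∃ m, ∀ y ∈ (s a).ctx.1, y.2 < m := by
      obtain ⟨b, hb⟩ := (((s a).ctx.1.map Prod.snd).finite_toSet).bddAbove
      obtain ⟨m, hm⟩ := exists_gt b
      exact ⟨m, fun y hy => (hb (List.mem_map_of_mem hy)).trans_lt hm⟩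
    -- The positions assigned to `a` number `Λ`, but fewer than `Λ` of all positions lie below `m`,
    -- because `Λ` is an initial ordinal.
    obtain ⟨k, hk⟩ : ∃ k, m ≤ p.symm (a, k) := by
      by_contra! hk
      have h₁ := Cardinal.mk_le_of_injective (f := fun k => (⟨p.symm (a, k), hk k⟩ : Set.Iio m))
        fun k l h => (Prod.mk.inj (p.symm.injective (congrArg Subtype.val h))).2
      have h₂ := Cardinal.mk_Iio_lt m
        ((congrArg Cardinal.ord (Cardinal.mk_ord_toType _)).trans (Ordinal.type_toType _).symm)
      exact absurd h₂ h₁.not_gt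
    refine ⟨p.symm (a, k), ?_⟩
    beta_reduce
    rw [Equiv.apply_symm_apply, if_pos fun y hy => (hm y hy).trans_le hk]

/-- By independence of the point, every constant may be replaced by one carrying the least label
`z`. All elements then live over one list `Z`, which may be used at every position except `z`
itself. That position is reserved for the top element, which needs no constants. -/
theorem exists_listing_of_finite (hP : IsPrimary P) [Finite (Label P)] (B : C) :
    ∃ f : Label P → FormRep P (Label P) B, (∀ j, ∀ y ∈ (f j).ctx.1, y.2 < j) ∧
      ∀ α : Fib (addConst P (Label P)) ⟨B⟩, ∃ j, α = addConst.cls (A := ⟨B⟩) (f j) := by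
  classical
  choose t ht using hP.exists_top
  have e := (nonempty_label_equiv P).some
  have : Finite (Σ X : C, Fib P X) := Finite.of_equiv _ e
  have : Finite C := Finite.of_injective (fun X : C => (⟨X, t X⟩ : Σ X : C, Fib P X))
    fun X Y h => congrArg Sigma.fst h
  have (A : C) : Finite (Fib P A) := Finite.of_injective (Sigma.mk A) sigma_mk_injective
  have : Fintype C := Fintype.ofFinite C
  have : Nonempty (Label P) := ⟨e.symm ⟨B, t B⟩⟩
  obtain ⟨z, hz⟩ : ∃ z : Label P, ∀ j, z ≤ j := Finite.exists_min id
  let Z : Ctx C (Label P) := ⟨(Finset.univ : Finset C).toList.map fun X => (X, z),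
    (Finset.nodup_toList _).map fun X Y h => congrArg Prod.fst h⟩
  have hZ (X : C) : (X, z) ∈ Z.1 := by simp [Z]
  have hZ' (y) (hy : y ∈ Z.1) : y.2 = z := by
    obtain ⟨X, -, rfl⟩ := List.mem_map.1 hy
    rfl
  have key (α : Fib (addConst P (Label P)) ⟨B⟩) :
      ∃ φ : Fib P (Z.prod ⊗ B), α = fcls Z φ := by
    obtain ⟨X, φ, rfl⟩ := exists_fcls α
    -- The relabelling that sends each constant `(X_i, x_i)` to `(X_i, z)`.
    let r : Z.prod ⟶ X.prod := Pi.lift fun y => Z.proj (y.1.1, z) (hZ _)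
    refine ⟨re P (r ▷ B) φ, ?_⟩
    rw [fcls_mono (X.le_left Z), fcls_mono (X.le_right Z), ← re_comp, ← comp_whiskerRight]
    -- The factors are exchanged so that `X.prod` is the evaluated one; the two points are the
    -- original tuple of constants and the relabelled tuple.
    have h := re_lift_eq_of_finite (snd (X.join Z).prod B)
      (fst _ _ ≫ Ctx.restr (X.le_left Z)) (fst _ _ ≫ Ctx.restr (X.le_right Z) ≫ r)
      (re P (lift (snd B X.prod) (fst B X.prod)) φ)
    simp only [← re_comp, comp_lift, lift_fst, lift_snd] at h
    have e (k : (X.join Z).prod ⟶ X.prod) : k ▷ B = lift (fst _ _ ≫ k) (snd _ _) := by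
      apply CartesianMonoidalCategory.hom_ext <;> simp
    rw [e, e, h]
  -- The transposition places the top element of the fiber at position `z`, where no label is
  -- allowed.
  let g : Fib P (Z.prod ⊗ B) → Label P := fun φ =>
    Equiv.swap (e.symm ⟨_, t (Z.prod ⊗ B)⟩) z (e.symm ⟨_, φ⟩)
  have hg : Function.Injective g :=
    (Equiv.injective _).comp (e.symm.injective.comp sigma_mk_injective)
  have hg' : g (t _) = z := Equiv.swap_apply_left _ _
  refine ⟨fun j => if h : j ≠ z ∧ ∃ φ, g φ = j then ⟨Z, h.2.choose⟩ else FormRep.const _ (t B),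
    fun j y hy => ?_, fun α => ?_⟩
  · beta_reduce at hy
    split_ifs at hy with h
    · rw [hZ' y hy]
      exact lt_of_le_of_ne (hz j) h.1.symm
    · exact absurd hy List.not_mem_nil
  · obtain ⟨φ, rfl⟩ := key α
    refine ⟨g φ, ?_⟩
    beta_reduce
    by_cases h : g φ = z
    · rw [dif_neg fun h' => h'.1 h]
      obtain rfl := hg (h.trans hg'.symm)
      exact (addConst.top_isTop hP (ht B) _).antisymm (fcls_isTop Z hP (ht _) _)
    · have h' : g φ ≠ z ∧ ∃ χ, g χ = g φ := ⟨h, φ, rfl⟩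
      rw [dif_pos h', hg h'.2.choose_spec]
      rfl

theorem nonempty_listing (hP : IsPrimary P) : Nonempty (Listing P) :=
  Listing.nonempty_of_forall fun B => by
    rcases finite_or_infinite (Label P) with h | h
    exacts [exists_listing_of_finite hP B, exists_listing_of_infinite hP B]

end Existence


open addConst addAxioms ConstBase

/-! ### Interpreting constants by points of the target category. -/

section Points

variable {C : Type u} [Category.{v} C] [CartesianMonoidalCategory C]
  {D : Type u₂} [Category.{v₂} D] [CartesianMonoidalCategory D]
  (F : C ⥤ D) [PreservesFiniteProducts F] {Λ : Type x}

theorem map_tensor_ext {X Y : C} {S : D} {f g : S ⟶ F.obj (X ⊗ Y)}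
    (h₁ : f ≫ F.map (fst X Y) = g ≫ F.map (fst X Y))
    (h₂ : f ≫ F.map (snd X Y) = g ≫ F.map (snd X Y)) : f = g := by
  rw [← cancel_mono (CartesianMonoidalCategory.prodComparison F X Y)]
  apply CartesianMonoidalCategory.hom_ext <;> simpa

/-- The section of `F(X × A) ⟶ FA` given by a point of `FX`. -/
noncomputable def pointSec {X : C} (t : 𝟙_ D ⟶ F.obj X) (A : C) : F.obj A ⟶ F.obj (X ⊗ A) :=
  lift (toUnit _ ≫ t) (𝟙 _) ≫ inv (CartesianMonoidalCategory.prodComparison F X A)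

variable {F}

@[simp] theorem pointSec_fst {X : C} (t : 𝟙_ D ⟶ F.obj X) (A : C) :
    pointSec F t A ≫ F.map (fst X A) = toUnit _ ≫ t := by simp [pointSec]

@[simp] theorem pointSec_snd {X : C} (t : 𝟙_ D ⟶ F.obj X) (A : C) :
    pointSec F t A ≫ F.map (snd X A) = 𝟙 _ := by simp [pointSec]

theorem pointSec_whiskerRight {X Y : C} (t : 𝟙_ D ⟶ F.obj X) (f : X ⟶ Y) (A : C) :
    pointSec F t A ≫ F.map (f ▷ A) = pointSec F (t ≫ F.map f) A := by
  apply map_tensor_ext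
  · rw [Category.assoc, ← F.map_comp, whiskerRight_fst, F.map_comp, ← Category.assoc]
    simp
  · rw [Category.assoc, ← F.map_comp, whiskerRight_snd]
    simp

/-- Substituting the constants `t` before or after forming `f` has the same effect. This gives
functoriality of `constFunctor` and naturality of `extendConst`. -/
theorem pointSec_lift {X A B : C} (t : 𝟙_ D ⟶ F.obj X) (f : X ⊗ A ⟶ B) :
    pointSec F t A ≫ F.map (lift (fst X A) f) = (pointSec F t A ≫ F.map f) ≫ pointSec F t B := by
  apply map_tensor_ext
  · rw [Category.assoc, ← F.map_comp, lift_fst]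
    simp only [Category.assoc, pointSec_fst]
    simp only [← Category.assoc]
    congr 1
    exact toUnit_unique _ _
  · rw [Category.assoc, ← F.map_comp, lift_snd]
    simp

/-- Converts Beck–Chevalley along the point `t` into a quantification over the terminal object of an
element reindexed along `snd`, the shape that richness requires. -/
theorem whiskerRight_inv_prodComparison {X : C} (t : 𝟙_ D ⟶ F.obj X) (A : C) :
    t ▷ F.obj A ≫ inv (CartesianMonoidalCategory.prodComparison F X A) =
      snd _ _ ≫ pointSec F t A := by
  rw [pointSec, ← Category.assoc, cancel_mono]
  apply CartesianMonoidalCategory.hom_ext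
  · simp only [whiskerRight_fst, Category.assoc, lift_fst]
    rw [← Category.assoc]
    congr 1
    exact toUnit_unique _ _
  · simp

variable (F)

/-- The limit fan of the image of `ΠX̄`. -/
noncomputable def isLimitMapProd (X : Ctx C Λ) :
    IsLimit (F.mapCone (limit.cone (Discrete.functor fun y : {y // y ∈ X.1} => y.1.1))) :=
  haveI : PreservesLimitsOfShape (Discrete {y // y ∈ X.1}) F := inferInstance
  isLimitOfPreserves F (limit.isLimit _)

variable {F}

theorem map_prod_ext {X : Ctx C Λ} {S : D} {f g : S ⟶ F.obj X.prod}
    (h : ∀ y hy, f ≫ F.map (X.proj y hy) = g ≫ F.map (X.proj y hy)) : f = g :=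
  (isLimitMapProd F X).hom_ext fun ⟨y⟩ => h y.1 y.2

/-- The point of `F(ΠX̄)` with given components. -/
noncomputable def tuple (X : Ctx C Λ) (c : ∀ y ∈ X.1, 𝟙_ D ⟶ F.obj y.1) : 𝟙_ D ⟶ F.obj X.prod :=
  (isLimitMapProd F X).lift
    { pt := 𝟙_ D
      π := Discrete.natTrans fun y => c y.as.1 y.as.2 }

@[simp] theorem tuple_proj (X : Ctx C Λ) (c : ∀ y ∈ X.1, 𝟙_ D ⟶ F.obj y.1) (y) (hy : y ∈ X.1) :
    tuple X c ≫ F.map (X.proj y hy) = c y hy :=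
  (isLimitMapProd F X).fac _ ⟨⟨y, hy⟩⟩

theorem tuple_restr {X Y : Ctx C Λ} (h : X ≤ Y) (c : ∀ y : C × Λ, 𝟙_ D ⟶ F.obj y.1) :
    tuple Y (fun y _ => c y) ≫ F.map (Ctx.restr h) = tuple X (fun y _ => c y) := by
  apply map_prod_ext
  intro y hy
  rw [Category.assoc, ← F.map_comp, Ctx.restr_proj, tuple_proj, tuple_proj]

variable (c : ∀ y : C × Λ, 𝟙_ D ⟶ F.obj y.1)

/-- The section of `F(ΠX̄ × A) ⟶ FA` given by an interpretation `c` of the constants. -/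
noncomputable def ctxSec (X : Ctx C Λ) (A : C) : F.obj A ⟶ F.obj (X.prod ⊗ A) :=
  pointSec F (tuple X fun y _ => c y) A

theorem ctxSec_restr {X Y : Ctx C Λ} (h : X ≤ Y) (A : C) :
    ctxSec c Y A ≫ F.map (Ctx.restr h ▷ A) = ctxSec c X A := by
  rw [ctxSec, pointSec_whiskerRight, tuple_restr, ctxSec]

theorem ctxSec_extend {A B : C} (f : ArrRep Λ A B) {Z : Ctx C Λ} (h : f.ctx ≤ Z) :
    ctxSec c Z A ≫ F.map (f.extend h) = ctxSec c f.ctx A ≫ F.map f.arr := by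
  rw [ArrRep.extend, F.map_comp, ← Category.assoc, ctxSec_restr]

/-- The functor `C̲ ⥤ D` that extends `F` and interprets the constants by `c`. -/
noncomputable def constFunctor : ConstBase C Λ ⥤ D where
  obj A := F.obj A.of
  map {A B} := Quotient.lift (fun f : ArrRep Λ A.of B.of => ctxSec c f.ctx A.of ≫ F.map f.arr)
    fun f g ⟨Z, h, k, e⟩ => by rw [← ctxSec_extend c f h, ← ctxSec_extend c g k, e]
  map_id A := by
    change ctxSec c _ A.of ≫ F.map (snd _ _ ≫ 𝟙 _) = _
    rw [Category.comp_id, ctxSec, pointSec_snd]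
  map_comp {A B E} f g := by
    obtain ⟨f, rfl⟩ := exists_cls f
    obtain ⟨g, rfl⟩ := exists_cls g
    change ctxSec c (f.ctx.join g.ctx) A.of ≫ F.map (lift (fst _ _) (f.extend _) ≫ g.extend _) =
      (ctxSec c f.ctx A.of ≫ F.map f.arr) ≫ ctxSec c g.ctx B.of ≫ F.map g.arr
    rw [F.map_comp, ← Category.assoc, ctxSec, pointSec_lift, Category.assoc]
    exact congrArg₂ (· ≫ ·) (ctxSec_extend c f _) (ctxSec_extend c g _)

theorem constFunctor_map_incl {A B : C} (f : A ⟶ B) :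
    (constFunctor c).map ((incl C Λ).map f) = F.map f := by
  change ctxSec c _ A ≫ F.map (snd _ _ ≫ f) = _
  rw [F.map_comp, ← Category.assoc, ctxSec, pointSec_snd, Category.id_comp]

theorem constFunctor_preservesFiniteProducts : PreservesFiniteProducts (constFunctor c) := by
  have (A B : ConstBase C Λ) :
      IsIso (CartesianMonoidalCategory.prodComparison (constFunctor c) A B) := by
    -- The projections of `C̲` are classes of projections of `C`, on which the functor agrees with
    -- `F`.
    have e : CartesianMonoidalCategory.prodComparison (constFunctor c) A B =
        CartesianMonoidalCategory.prodComparison F A.of B.of :=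
      congrArg₂ lift (constFunctor_map_incl c (fst A.of B.of))
        (constFunctor_map_incl c (snd A.of B.of))
    rw [e]
    exact inferInstanceAs (IsIso (CartesianMonoidalCategory.prodComparison F A.of B.of))
  have (A B : ConstBase C Λ) := preservesLimit_pair_of_isIso_prodComparison (constFunctor c) A B
  have : PreservesLimitsOfShape (Discrete WalkingPair) (constFunctor c) :=
    ⟨fun {K} => preservesLimit_of_iso_diagram _ (diagramIsoPair K).symm⟩
  have h : IsTerminal ((constFunctor c).obj (𝟙_ (ConstBase C Λ))) :=
    IsTerminal.isTerminalObj F (𝟙_ C) isTerminalTensorUnit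
  have : PreservesLimit (Functor.empty.{0} (ConstBase C Λ)) (constFunctor c) :=
    preservesLimit_of_preserves_limit_cone isTerminalTensorUnit
      ((isLimitMapConeEmptyConeEquiv (constFunctor c) _).symm h)
  have : PreservesLimitsOfShape (Discrete.{0} PEmpty) (constFunctor c) :=
    preservesLimitsOfShape_pempty_of_preservesTerminal _
  exact .of_preserves_binary_and_terminal _

end Points

/-- A monotone map into a partial order, on the antisymmetrization of its source. -/
def antisymmetrizationLift {α β : Type*} [Preorder α] [PartialOrder β] (f : α →o β) :
    Antisymmetrization α (· ≤ ·) →o β where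
  toFun := Quotient.lift f fun _ _ h => (f.monotone h.1).antisymm (f.monotone h.2)
  monotone' a b h := by
    induction a using Antisymmetrization.ind
    induction b using Antisymmetrization.ind
    exact f.monotone h

/-! ### Extending a morphism along added constants and along added axioms. -/

namespace DoctrineHom

variable {C : Type u} [Category.{v} C] [CartesianMonoidalCategory C]
  {D : Type u₂} [Category.{v₂} D] [CartesianMonoidalCategory D]
  {P : Cᵒᵖ ⥤ PartOrd.{w}} {R : Dᵒᵖ ⥤ PartOrd.{w₂}} {Λ : Type x}

/-- The components take values in fibers over objects that depend on the functor, so they can be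
compared only heterogeneously until the functors are identified. -/
theorem ext_of_heq {F G : DoctrineHom P R} (h : F.functor = G.functor)
    (k : ∀ A α, HEq (F.app A α) (G.app A α)) : F = G := by
  obtain ⟨F, _, f, _⟩ := F
  obtain ⟨G, _, g, _⟩ := G
  obtain rfl : F = G := h
  obtain rfl : f = g := funext fun A => OrderHom.ext _ _ (funext fun α => eq_of_heq (k A α))
  rfl

section AddConst

variable (H : DoctrineHom P R) (c : ∀ y : C × Λ, 𝟙_ D ⟶ H.functor.obj y.1)

theorem re_ctxSec_extend {A : C} (φ : FormRep P Λ A) {Z : Ctx C Λ} (h : φ.ctx ≤ Z) :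
    re R (ctxSec c Z A) (H.app _ (φ.extend h)) = re R (ctxSec c φ.ctx A) (H.app _ φ.form) := by
  rw [FormRep.extend, H.naturality, ← re_comp, ctxSec_restr]

theorem re_ctxSec_mono {A : C} {φ ψ : FormRep P Λ A} (h : φ ≤ ψ) :
    re R (ctxSec c φ.ctx A) (H.app _ φ.form) ≤ re R (ctxSec c ψ.ctx A) (H.app _ ψ.form) := by
  obtain ⟨Z, h, k, e⟩ := h
  rw [← re_ctxSec_extend H c φ h, ← re_ctxSec_extend H c ψ k]
  exact (re R _).monotone ((H.app _).monotone e)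

/-- The morphism `P̲ → R` that extends `H` and interprets the constants by `c`. -/
noncomputable def extendConst : DoctrineHom (addConst P Λ) R where
  functor := constFunctor c
  preservesFiniteProducts := constFunctor_preservesFiniteProducts c
  app A := antisymmetrizationLift
    { toFun := fun φ : FormRep P Λ A.of => re R (ctxSec c φ.ctx A.of) (H.app _ φ.form)
      monotone' := fun _ _ h => re_ctxSec_mono H c h }
  naturality {A B} f β := by
    obtain ⟨A⟩ := A
    obtain ⟨B⟩ := B
    obtain ⟨f, rfl⟩ := exists_cls f
    obtain ⟨φ, rfl⟩ := exists_cls β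
    change re R (ctxSec c (f.ctx.join φ.ctx) A)
      (H.app _ (re P (lift (fst _ _) (f.extend _)) (φ.extend _))) =
      re R (ctxSec c f.ctx A ≫ H.functor.map f.arr) (re R (ctxSec c φ.ctx B) (H.app _ φ.form))
    rw [H.naturality, ← re_comp, ctxSec, pointSec_lift, re_comp, ← ctxSec, ← ctxSec,
      re_ctxSec_extend, ctxSec_extend]

theorem extendConst_app_fcls {A : C} (Z : Ctx C Λ) (φ : Fib P (Z.prod ⊗ A)) :
    (H.extendConst c).app ⟨A⟩ (fcls Z φ) = re R (ctxSec c Z A) (H.app _ φ) := rfl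

variable {H}

theorem extendConst_isPrimary (hH : H.IsPrimary) : (H.extendConst c).IsPrimary where
  source := hH.source.addConst Λ
  target := hH.target
  top {A t} ht := by
    obtain ⟨A⟩ := A
    obtain ⟨s, hs⟩ := hH.source.exists_top ((Ctx.empty : Ctx C Λ).prod ⊗ A)
    obtain rfl := (fcls_isTop Ctx.empty hH.source hs t).antisymm (ht _)
    exact hH.target.re_top _ (hH.top hs)
  meet {A α β m} hm := by
    obtain ⟨A⟩ := A
    obtain ⟨Z, φ, ψ, rfl, rfl⟩ := exists_fcls₂ α β
    have k := hH.source.meet_isGLB φ ψ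
    obtain rfl := hm.unique (fcls_isGLB Z hH.source k)
    exact hH.target.re_meet _ (hH.meet k)

end AddConst

section AddAxioms

variable {G : DoctrineHom P R} {hP : RichDoctrine.IsPrimary P} {ι : Type x} {ψ : ι → Fib P (𝟙_ C)}

theorem app_bigMeet_isTop (hG : G.IsPrimary) (hψ : ∀ i, IsTop (G.app _ (ψ i))) (W : Finset ι) :
    IsTop (G.app _ (hP.bigMeet W ψ)) := by
  classical
  induction W using Finset.induction_on with
  | empty => exact hG.top fun _ => hP.le_bigMeet.2 (by simp)
  | insert a s _ ih =>
    have e : hP.bigMeet (insert a s) ψ = hP.meet (ψ a) (hP.bigMeet s ψ) :=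
      eq_of_forall_le_iff fun γ => by simp [hP.le_bigMeet, hP.le_meet]
    rw [e]
    exact fun γ => (hG.meet (hP.meet_isGLB (ψ a) (hP.bigMeet s ψ))).2 (by
      rintro _ (rfl | rfl)
      exacts [hψ a γ, ih γ])

/-- If `α ∧ ⋀ψ ≤ β` and `G` makes the axioms true, then meeting with them costs nothing after `G` is
applied. -/
theorem app_form_mono (hG : G.IsPrimary) (hψ : ∀ i, IsTop (G.app _ (ψ i))) {A : C}
    {α β : AxRep hP ψ A} (h : α ≤ β) : G.app A α.form ≤ G.app A β.form := by
  obtain ⟨W, -, -, e⟩ := h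
  refine le_trans ?_ ((G.app A).monotone (e.trans (hP.meet_le_left _ _)))
  refine (hG.meet (hP.meet_isGLB α.form _)).2 ?_
  rintro _ (rfl | rfl)
  · exact le_rfl
  · rw [G.naturality]
    exact hG.target.re_top _ (app_bigMeet_isTop hG hψ W) _

/-- The extension of a morphism that sends all the axioms to the top element. -/
noncomputable def extendAxioms (hG : G.IsPrimary) (hψ : ∀ i, IsTop (G.app _ (ψ i))) :
    DoctrineHom (addAxioms hP ψ) R where
  functor := G.functor
  preservesFiniteProducts := inferInstance
  app A := antisymmetrizationLift
    { toFun := fun α : AxRep hP ψ A => G.app A α.form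
      monotone' := fun _ _ h => app_form_mono hG hψ h }
  naturality f β := by
    induction β using Antisymmetrization.ind
    exact G.naturality f _

end AddAxioms

end DoctrineHom


open addConst addAxioms ConstBase

/-! ### Choosing witnesses in a rich doctrine and extending along `P → P⃗`. -/

section Interpretation

variable {C : Type u} [Category.{v} C] [CartesianMonoidalCategory C]
  {D : Type u₂} [Category.{v₂} D] [CartesianMonoidalCategory D]
  {P : Cᵒᵖ ⥤ PartOrd.{w}} {R : Dᵒᵖ ⥤ PartOrd.{w₂}}

/-- `d` is a witness for the existential quantification of `σ`. -/
def IsWitness (R : Dᵒᵖ ⥤ PartOrd.{w₂}) {A : D} (σ : Fib R A) (d : 𝟙_ D ⟶ A) : Prop :=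
  ∀ e : Fib R (𝟙_ D), IsEx R (re R (snd (𝟙_ D) A) σ) e → e ≤ re R d σ

variable (L : Listing P) (H : DoctrineHom P R)

theorem Listing.wit_injective (B : C) : Function.Injective (L.wit B) :=
  StrictMono.injective fun _ j h => (L.wit_isLeast B j).1.1 _ h

/-- The formula `φ^B_j` with the constants of its context replaced by the components of `c`. -/
noncomputable def Listing.instForm (B : C) (j : Label P)
    (c : ∀ y ∈ (L.ctx B j).1, 𝟙_ D ⟶ H.functor.obj y.1) : Fib R (H.functor.obj B) :=
  re R (pointSec H.functor (tuple _ c) B) (H.app _ (L.form B j))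

/-- Recursion on the label, for all objects at once: the constants occurring in `φ^B_j` have labels
below `d^B_j`, so the instance to be witnessed is already determined at that stage. Richness of `R`
then supplies the witness. -/
theorem Listing.exists_interpretation (hR : IsRich R) :
    ∃ c : ∀ y : C × Label P, 𝟙_ D ⟶ H.functor.obj y.1, ∀ B j,
      IsWitness R (L.instForm H B j fun y _ => c y) (c (B, L.wit B j)) := by
  classical
  choose wt hwt using fun (A : D) (σ : Fib R A) => hR.exists_witness σ
  choose t ht using hR.exists_top
  let step (o : Label P) (rec : ∀ o' : Label P, o' < o → ∀ B : C, 𝟙_ D ⟶ H.functor.obj B) (B : C) :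
      𝟙_ D ⟶ H.functor.obj B :=
    if h : ∃ j, L.wit B j = o then
      wt _ (L.instForm H B h.choose fun y hy =>
        rec y.2 (((L.wit_isLeast B h.choose).1.2 _ le_rfl y hy).trans_eq h.choose_spec) y.1)
    -- A label that is no `d^B_j` may receive any point of `FB`; richness applied to the top element
    -- provides one.
    else wt _ (t _)
  let c : ∀ o : Label P, ∀ B : C, 𝟙_ D ⟶ H.functor.obj B := WellFounded.fix wellFounded_lt step
  refine ⟨fun y => c y.2 y.1, fun B j => ?_⟩
  have h : ∃ k, L.wit B k = L.wit B j := ⟨j, rfl⟩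
  have e : c (L.wit B j) B = wt _ (L.instForm H B j fun y _ => c y.2 y.1) := by
    refine (congrFun (WellFounded.fix_eq wellFounded_lt step (L.wit B j)) B).trans
      ((dif_pos h).trans ?_)
    -- Injectivity of `j ↦ d^B_j` ensures that a label witnesses only one formula over `B`, so the
    -- index chosen in the recursion is `j`.
    have hj : h.choose = j := L.wit_injective B h.choose_spec
    exact congrArg (fun k => wt _ (L.instForm H B k fun y _ => c y.2 y.1)) hj
  change IsWitness R _ (c (L.wit B j) B)
  rw [e]
  exact hwt _ _

variable {L H} {c : ∀ y : C × Label P, 𝟙_ D ⟶ H.functor.obj y.1}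
  (hI : IsImplicational P) (hE : IsExistential P)

/-- By Beck–Chevalley along the tuple of interpreted constants, the instance of `∃φ` is the
existential quantification of the instance of `φ`, to which the witness property applies. -/
theorem re_tuple_ex_le {B : C} {j : Label P}
    (hc : IsWitness R (L.instForm H B j fun y _ => c y) (c (B, L.wit B j)))
    (hH : H.IsExistential) : re R (tuple (L.ctx B j) fun y _ => c y) (H.app _ (hE.ex (L.form B j))) ≤
      re R (c (B, L.wit B j)) (L.instForm H B j fun y _ => c y) := by
  refine hc _ ?_
  have h := hH.target.beck_chevalley (tuple (L.ctx B j) fun y _ => c y)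
    (hH.ex (hE.ex_isEx (L.form B j)))
  rwa [DoctrineHom.appProd, ← re_comp, whiskerRight_inv_prodComparison, re_comp] at h

/-- The image of the axiom is an implication whose antecedent is the instance of `∃φ` and whose
consequent is the instance of `φ` at the chosen witness; it is true because the former lies below
the latter. -/
theorem henkinAx_isTop
    (hc : ∀ B j, IsWitness R (L.instForm H B j fun y _ => c y) (c (B, L.wit B j)))
    (hHI : H.IsImplicational) (hHE : H.IsExistential) (y : C × Label P) :
    IsTop ((H.extendConst c).app _ (L.henkinAx hI hE y)) := by
  obtain ⟨B, j⟩ := y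
  rw [L.henkinAx_eq]
  let X := L.ctx B j
  let k := ctxSec c (L.ctxStar B j) (𝟙_ C) ≫ H.functor.map (L.axArr B j)
  -- Interpreting the enlarged list amounts to interpreting the old constants by `c` and placing the
  -- witness in the variable of `φ^B_j`.
  have hk : k = (toUnit _ ≫ c (B, L.wit B j)) ≫ pointSec H.functor (tuple X fun y _ => c y) B := by
    apply map_tensor_ext
    · rw [Category.assoc, ← H.functor.map_comp, Category.assoc, pointSec_fst, Listing.axArr,
        Category.assoc, lift_fst, H.functor.map_comp, ← Category.assoc, ctxSec, pointSec_fst,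
        Category.assoc, tuple_restr, ← Category.assoc]
      congr 1
      exact toUnit_unique _ _
    · rw [Category.assoc, ← H.functor.map_comp, Category.assoc, pointSec_snd, Listing.axArr,
        Category.assoc, lift_snd, H.functor.map_comp, ← Category.assoc, ctxSec, pointSec_fst,
        Category.assoc, tuple_proj, Category.comp_id]
  have e : (H.extendConst c).app ⟨𝟙_ C⟩ (fcls (L.ctxStar B j) (re P (L.axArr B j)
      (L.axForm hI hE B j))) = re R k (H.app _ (L.axForm hI hE B j)) := by
    rw [DoctrineHom.extendConst_app_fcls, H.naturality, ← re_comp]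
  have hi := hHI.target.re_imp k (hHI.imp (hI.imp_isImp (re P (fst _ _) (hE.ex (L.form B j)))
    (L.form B j)))
  refine (congrArg IsTop e).mpr (hi.isTop hHI.target.toIsPrimary ?_)
  -- The image under `H` of the terminal object is terminal but need not be `𝟙_ D`, hence the
  -- reindexing along `toUnit`.
  have h := (re R (toUnit (H.functor.obj (𝟙_ C)))).monotone (re_tuple_ex_le hE (hc B j) hHE)
  rw [H.naturality, ← re_comp, hk, Category.assoc, pointSec_fst]
  rw [Listing.instForm, ← re_comp, ← re_comp, ← re_comp] at h
  simp only [Category.assoc] at h ⊢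
  convert h using 3
  rw [← Category.assoc, ← Category.assoc]
  exact congrArg (· ≫ _) (toUnit_unique _ _)

/-- The morphism `P⃗ → R` that extends `H` and interprets the constants by witnesses. -/
noncomputable def extendRich
    (hc : ∀ B j, IsWitness R (L.instForm H B j fun y _ => c y) (c (B, L.wit B j)))
    (hHI : H.IsImplicational) (hHE : H.IsExistential) : DoctrineHom (L.rich hI hE) R :=
  DoctrineHom.extendAxioms (DoctrineHom.extendConst_isPrimary c hHI.primary)
    (henkinAx_isTop hI hE hc hHI hHE)

theorem toRich_comp_extendRich
    (hc : ∀ B j, IsWitness R (L.instForm H B j fun y _ => c y) (c (B, L.wit B j)))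
    (hHI : H.IsImplicational) (hHE : H.IsExistential) :
    (L.toRich hI hE).comp (extendRich hI hE hc hHI hHE) = H := by
  refine DoctrineHom.ext_of_heq ?_ fun A α => heq_of_eq ?_
  · exact Functor.hext (fun _ => rfl) fun A B f => heq_of_eq (constFunctor_map_incl c f)
  · change re R (ctxSec c Ctx.empty A) (H.app _ (re P (snd _ _) α)) = H.app A α
    rw [H.naturality, ← re_comp, ctxSec, pointSec_snd, re_id]

end Interpretation

end RichDoctrine
theorem mainTheorem6 {C : Type u} [Category.{v} C] [CartesianMonoidalCategory C]
    (P : Cᵒᵖ ⥤ PartOrd.{w}) (hI : RichDoctrine.IsImplicational P) (hE : RichDoctrine.IsExistential P) :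
    Nonempty (RichDoctrine.Listing P) ∧ ∀ L : RichDoctrine.Listing P,
      (L.toRich hI hE).IsImplicational ∧ (L.toRich hI hE).IsExistential ∧
      RichDoctrine.IsRich (L.rich hI hE) ∧
      ∀ {D : Type u₂} [Category.{v₂} D] [CartesianMonoidalCategory D] (R : Dᵒᵖ ⥤ PartOrd.{w₂}),
        RichDoctrine.IsImplicational R → RichDoctrine.IsExistential R → RichDoctrine.IsRich R →
        ∀ H : RichDoctrine.DoctrineHom P R, H.IsImplicational → H.IsExistential →
          (∃ G : RichDoctrine.DoctrineHom (L.rich hI hE) R, G.IsImplicational ∧ G.IsExistential ∧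
            (L.toRich hI hE).comp G = H) ∧
          ∀ G : RichDoctrine.DoctrineHom (L.rich hI hE) R, G.IsImplicational → G.IsExistential →
            (L.toRich hI hE).comp G = H →
            (H.IsBounded → G.IsBounded) ∧ (H.IsUniversal → G.IsUniversal) ∧
            (H.IsElementary → G.IsElementary) := by
  refine ⟨RichDoctrine.nonempty_listing hI.toIsPrimary, fun L =>
    ⟨L.toRich_isImplicational hI hE, L.toRich_isExistential hI hE, L.rich_isRich hI hE, ?_⟩⟩
  intro D _ _ R hRI hRE hR H hHI hHE
  refine ⟨?_, ?_⟩
  · obtain ⟨c, hc⟩ := L.exists_interpretation H hR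
    have h := RichDoctrine.toRich_comp_extendRich hI hE hc hHI hHE
    exact ⟨RichDoctrine.extendRich hI hE hc hHI hHE,
      RichDoctrine.Listing.isImplicational_of_comp (by rw [h]; exact hHI),
      RichDoctrine.Listing.isExistential_of_comp (by rw [h]; exact hHE), h⟩
  -- With `H` replaced by the composite, the claims concern an arbitrary `G` and depend only on its
  -- restriction to `P`.
  · rintro G - - rfl
    exact ⟨RichDoctrine.Listing.isBounded_of_comp, RichDoctrine.Listing.isUniversal_of_comp,
      RichDoctrine.Listing.isElementary_of_comp⟩
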